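/- All rings are commutative with $1$, all distributive lattices are bounded, and lattice homomorphisms preserve $0$ and $1$. **Ringed lattices.** A *ringed lattice* $X=(L_X,\mathcal O_X)$ is a distributive lattice $L_X$ together with a ring-valued presheaf $\mathcal O_X$ on the poset $L_X$ which is a sheaf: whenever $x=u_1\vee\dots\vee u_n$, the diagram $\mathcal O_X(x)\to\prod_i\mathcal O_X(u_i)\rightrightarrows\prod_{i,j}\mathcal O_X(u_i\wedge u_j)$ is an equalizer. A morphism of ringed lattices $\pi:X\to Y$ (written in the geometric direction, i.e. in the opposite category) is a lattice homomorphism $\pi^*:L_Y\to L_X$ together with a natural transformation $\pi^\sharp:\mathcal O_Y(-)\to\mathcal O_X(\pi^*(-))$. **Locally ringed lattices.** A map $d:R\to L$ from a ring to a distributive lattice is a *support* if $d(0)=0$, $d(1)=1$, $d(xy)=d(x)\wedge d(y)$ and $d(x+y)\le d(x)\vee d(y)$. A *locally ringed lattice* is a ringed lattice $X$ with, for each $u\in L_X$, a support $\mathcal D_u:\mathcal O_X(u)\to{\downarrow}u$ such that for all $s\in\mathcal O_X(u)$ and $w\le u$: $w\le\mathcal D_u(s)$ if and only if $s|_w$ is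 invertible in $\mathcal O_X(w)$. (Such $\mathcal D$ is unique if it exists; it is called the invertibility support.) A *morphism of locally ringed lattices* $\pi:X\to Y$ is a morphism of ringed lattices such that $\pi^*(\mathcal D_u(s))=\mathcal D_{\pi^*(u)}(\pi^\sharp(s))$ for all $u\in L_Y$ and $s\in\mathcal O_Y(u)$. For $u\in L_X$, $X|_u$ denotes the locally ringed lattice ${\downarrow}u$ with the restricted sheaf and invertibility support. **Spectra and schemes.** For a ring $R$, the Zariski lattice $\mathcal L_R$ consists of the classes $D(f_1,\dots,f_n)$ of finite lists of elements of $R$, modulo $\sqrt{\langle f_1,\dots,f_n\rangle}=\sqrt{\langle g_1,\dots,g_m\rangle}$, ordered by inclusion of radical ideals. With its structure sheaf $\mathcal O_R$, for which $\mathcal O_R(D(f))\cong R_f$ canonically, it is a locally ringed lattice $\mathsf{Spec}(R)$. For a locally ringed lattice $X$, a ring homomorphism $\varphi:R\to\mathcal O_X(1)$ induces a morphism of locally ringed lattices $X\to\mathsf{Spec}(R)$, given by $D(f)\mapsto\mathcal D_1(\varphi(f))$ on lattices and on the sections over $D(f)$ by the homomorphism $R_f\to\mathcal O_X(\mathcal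 D_1(\varphi(f)))$ induced by $\varphi$. For $\varphi=\mathrm{id}_{\mathcal O_X(1)}$ this is denoted $\eta_X:X\to\mathsf{Spec}(\mathcal O_X(1))$, and for $X=\mathsf{Spec}(A)$, $\varphi:R\to A\cong\mathcal O_A(1)$, it is denoted $\mathsf{Spec}(\varphi):\mathsf{Spec}(A)\to\mathsf{Spec}(R)$. $X$ is *affine* if $\eta_X$ is an isomorphism of locally ringed lattices. An *affine cover* of $X$ is a finite family $u_1,\dots,u_n\in L_X$ with $1=u_1\vee\dots\vee u_n$ and each $X|_{u_i}$ affine; $X$ is a *qcqs-scheme* if it has an affine cover. **Locally affine morphisms** (in the sense of Coquand–Lombardi–Schuster). Let $X,Y$ be qcqs-schemes. A morphism of ringed lattices $\pi:X\to Y$ is *locally affine* if there are affine covers $u_1,\dots,u_n$ of $X$ and $w_1,\dots,w_m$ of $Y$ such that for every $u_i$ there exists a $w_j$ with $u_i\le\pi^*(w_j)$ for which the induced morphism of ringed lattices $\pi|_{u_i}:X|_{u_i}\to Y|_{w_j}$, with underlying lattice homomorphism $v\mapsto\pi^*(v)\wedge u_i$ and with sheaf part $\pi^\sharp$ followed by restriction,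 satisfies $$\eta_{Y|_{w_j}}\circ\pi|_{u_i}=\mathsf{Spec}\big(\pi^\sharp|_{u_i}\big)\circ\eta_{X|_{u_i}},$$ where $\pi^\sharp|_{u_i}:\mathcal O_Y(w_j)\to\mathcal O_X(u_i)$ is the induced ring homomorphism. **Lemma.** Let $X$ and $Y$ be qcqs-schemes. Then a morphism of ringed lattices $\pi:X\to Y$ is locally affine if and only if it is a morphism of locally ringed lattices. -/

import Mathlib

open CategoryTheory Opposite TopologicalSpace

universe u

/-! ### Supports and the Zariski lattice of a commutative ring -/

/-- A map `d : R → L` from a commutative ring to a bounded distributive lattice is a *support*. -/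
structure IsSupport {R L : Type*} [CommRing R] [DistribLattice L] [BoundedOrder L]
    (d : R → L) : Prop where
  map_zero : d 0 = ⊥
  map_one : d 1 = ⊤
  map_mul : ∀ x y, d (x * y) = d x ⊓ d y
  map_add_le : ∀ x y, d (x + y) ≤ d x ⊔ d y

/-- The radical of the ideal generated by a list of elements. -/
def radicalSpan {R : Type*} [CommRing R] (l : List R) : Ideal R :=
  (Ideal.span {x | x ∈ l}).radical

/-- Two lists of generators are identified if they generate the same radical ideal. -/
def ZariskiLattice.setoid (R : Type*) [CommRing R] : Setoid (List R) :=
  Setoid.ker (radicalSpan (R := R))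

/-- The *Zariski lattice* of `R`: lists of generators `f₁, …, fₙ` modulo
`√⟨f₁, …, fₙ⟩ = √⟨g₁, …, gₘ⟩`. -/
def ZariskiLattice (R : Type*) [CommRing R] : Type _ :=
  Quotient (ZariskiLattice.setoid R)

namespace ZariskiLattice

variable {R : Type*} [CommRing R]

/-- The class `D(f₁, …, fₙ)` of a list of generators. -/
def mk (l : List R) : ZariskiLattice R := Quotient.mk (ZariskiLattice.setoid R) l

/-- The basic element `D(f)`. -/
def D (f : R) : ZariskiLattice R := mk [f]

/-- The radical ideal corresponding to an element of the Zariski lattice. -/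
def toIdeal : ZariskiLattice R → Ideal R :=
  Quotient.lift radicalSpan fun _ _ h => h

/-- The quasi-compact open subset of the prime spectrum given by an element of the
Zariski lattice: the complement of the vanishing locus of the ideal. -/
def toOpens (a : ZariskiLattice R) : Opens (PrimeSpectrum R) :=
  ⟨(PrimeSpectrum.zeroLocus (toIdeal a : Set R))ᶜ,
    (PrimeSpectrum.isClosed_zeroLocus _).isOpen_compl⟩

lemma mem_toOpens_mk (l : List R) (p : PrimeSpectrum R) :
    p ∈ toOpens (mk l) ↔ ∃ f ∈ l, f ∉ p.asIdeal := by
  change p ∉ PrimeSpectrum.zeroLocus (radicalSpan l : Set R) ↔ _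
  rw [radicalSpan, PrimeSpectrum.zeroLocus_radical, PrimeSpectrum.zeroLocus_span,
    PrimeSpectrum.mem_zeroLocus, Set.not_subset]
  rfl

lemma toOpens_D (f : R) : toOpens (D f) = PrimeSpectrum.basicOpen f := by
  ext p
  change p ∈ toOpens (mk [f]) ↔ p ∈ PrimeSpectrum.basicOpen f
  simp [mem_toOpens_mk, PrimeSpectrum.mem_basicOpen]

lemma radical_toIdeal (a : ZariskiLattice R) : (toIdeal a).radical = toIdeal a := by
  induction a using Quotient.inductionOn with
  | h l => exact Ideal.radical_idem _

lemma toOpens_le_iff_toIdeal {a b : ZariskiLattice R} :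
    toOpens a ≤ toOpens b ↔ toIdeal a ≤ toIdeal b := by
  change (PrimeSpectrum.zeroLocus (toIdeal a : Set R))ᶜ ⊆
    (PrimeSpectrum.zeroLocus (toIdeal b : Set R))ᶜ ↔ toIdeal a ≤ toIdeal b
  rw [Set.compl_subset_compl, PrimeSpectrum.zeroLocus_subset_zeroLocus_iff, radical_toIdeal]

lemma toIdeal_injective : Function.Injective (toIdeal (R := R)) := by
  intro a b
  induction a using Quotient.inductionOn
  induction b using Quotient.inductionOn
  exact fun h => Quotient.sound h

lemma toOpens_injective : Function.Injective (toOpens (R := R)) := fun _ _ h =>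
  toIdeal_injective (le_antisymm (toOpens_le_iff_toIdeal.1 h.le) (toOpens_le_iff_toIdeal.1 h.ge))

lemma toOpens_eq_of_mk {l l' : List R} (h : mk l = mk l') (p : PrimeSpectrum R) :
    (∃ f ∈ l, f ∉ p.asIdeal) ↔ ∃ f ∈ l', f ∉ p.asIdeal := by
  rw [← mem_toOpens_mk, ← mem_toOpens_mk, h]

/-- `D(f₁, …, fₙ) ⊔ D(g₁, …, gₘ) = D(f₁, …, fₙ, g₁, …, gₘ)`. -/
def sup : ZariskiLattice R → ZariskiLattice R → ZariskiLattice R := Quotient.map₂ (· ++ ·) (by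
  intro a a' h b b' h'
  have h1 : mk a = mk a' := Quotient.sound h
  have h2 : mk b = mk b' := Quotient.sound h'
  refine Quotient.exact (s := ZariskiLattice.setoid R) (toOpens_injective (a₁ := mk (a ++ b))
    (a₂ := mk (a' ++ b')) (SetLike.ext fun p => ?_))
  have e1 := toOpens_eq_of_mk h1 p
  have e2 := toOpens_eq_of_mk h2 p
  simp only [mem_toOpens_mk, List.mem_append, or_and_right, exists_or] at *
  rw [e1, e2])

lemma mem_mul_aux (l l' : List R) (p : PrimeSpectrum R) :
    (∃ f ∈ (l ×ˢ l').map fun x => x.1 * x.2, f ∉ p.asIdeal) ↔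
      (∃ f ∈ l, f ∉ p.asIdeal) ∧ ∃ f ∈ l', f ∉ p.asIdeal := by
  constructor
  · rintro ⟨f, hf, hp⟩
    obtain ⟨⟨x, y⟩, hx, rfl⟩ := List.mem_map.1 hf
    replace hx := List.pair_mem_product.1 hx
    exact ⟨⟨x, hx.1, fun h => hp (Ideal.mul_mem_right _ _ h)⟩,
      ⟨y, hx.2, fun h => hp (Ideal.mul_mem_left _ _ h)⟩⟩
  · rintro ⟨⟨x, hx, hxp⟩, ⟨y, hy, hyp⟩⟩
    exact ⟨x * y, List.mem_map.2 ⟨(x, y), List.pair_mem_product.2 ⟨hx, hy⟩, rfl⟩,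
      fun h => (p.isPrime.mem_or_mem h).elim hxp hyp⟩

/-- `D(f₁, …, fₙ) ⊓ D(g₁, …, gₘ) = D(f₁g₁, …, fᵢgⱼ, …, fₙgₘ)`. -/
def inf : ZariskiLattice R → ZariskiLattice R → ZariskiLattice R :=
  Quotient.map₂ (fun l l' => (l ×ˢ l').map fun x => x.1 * x.2) (by
  intro a a' h b b' h'
  have h1 : mk a = mk a' := Quotient.sound h
  have h2 : mk b = mk b' := Quotient.sound h'
  refine Quotient.exact (s := ZariskiLattice.setoid R) (toOpens_injective (a₁ := mk _)
    (a₂ := mk _) (SetLike.ext fun p => ?_))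
  rw [mem_toOpens_mk, mem_toOpens_mk, mem_mul_aux, mem_mul_aux, toOpens_eq_of_mk h1 p,
    toOpens_eq_of_mk h2 p])

lemma toOpens_sup_aux (a b : ZariskiLattice R) : toOpens (sup a b) = toOpens a ⊔ toOpens b := by
  induction a using Quotient.inductionOn with | h l => ?_
  induction b using Quotient.inductionOn with | h l' => ?_
  ext p
  change p ∈ toOpens (mk (l ++ l')) ↔ p ∈ toOpens (mk l) ∨ p ∈ toOpens (mk l')
  simp only [mem_toOpens_mk, List.mem_append, or_and_right, exists_or]

lemma toOpens_inf_aux (a b : ZariskiLattice R) : toOpens (inf a b) = toOpens a ⊓ toOpens b := by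
  induction a using Quotient.inductionOn with | h l => ?_
  induction b using Quotient.inductionOn with | h l' => ?_
  ext p
  change p ∈ toOpens (mk _) ↔ p ∈ toOpens (mk l) ∧ p ∈ toOpens (mk l')
  rw [mem_toOpens_mk, mem_toOpens_mk, mem_toOpens_mk, mem_mul_aux]

/-- The order is inclusion of radical ideals. -/
instance : DistribLattice (ZariskiLattice R) where
  le a b := toIdeal a ≤ toIdeal b
  le_refl _ := le_rfl
  le_trans _ _ _ h h' := le_trans (α := Ideal R) h h'
  le_antisymm _ _ h h' := toIdeal_injective (le_antisymm h h')
  sup := sup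
  inf := inf
  le_sup_left a b := toOpens_le_iff_toIdeal.1 ((toOpens_sup_aux a b).symm ▸ le_sup_left)
  le_sup_right a b := toOpens_le_iff_toIdeal.1 ((toOpens_sup_aux a b).symm ▸ le_sup_right)
  sup_le a b c h h' := toOpens_le_iff_toIdeal.1 ((toOpens_sup_aux a b).symm ▸
    sup_le (toOpens_le_iff_toIdeal.2 h) (toOpens_le_iff_toIdeal.2 h'))
  inf_le_left a b := toOpens_le_iff_toIdeal.1 ((toOpens_inf_aux a b).symm ▸ inf_le_left)
  inf_le_right a b := toOpens_le_iff_toIdeal.1 ((toOpens_inf_aux a b).symm ▸ inf_le_right)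
  le_inf a b c h h' := toOpens_le_iff_toIdeal.1 ((toOpens_inf_aux b c).symm ▸
    le_inf (toOpens_le_iff_toIdeal.2 h) (toOpens_le_iff_toIdeal.2 h'))
  le_sup_inf a b c := toOpens_le_iff_toIdeal.1 (by
    change toOpens (inf (sup a b) (sup a c)) ≤ toOpens (sup a (inf b c))
    rw [toOpens_inf_aux, toOpens_sup_aux, toOpens_sup_aux, toOpens_sup_aux, toOpens_inf_aux]
    exact le_sup_inf)

lemma toOpens_le_iff {a b : ZariskiLattice R} : toOpens a ≤ toOpens b ↔ a ≤ b :=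
  toOpens_le_iff_toIdeal

lemma toOpens_sup (a b : ZariskiLattice R) : toOpens (a ⊔ b) = toOpens a ⊔ toOpens b :=
  toOpens_sup_aux a b

lemma toOpens_inf (a b : ZariskiLattice R) : toOpens (a ⊓ b) = toOpens a ⊓ toOpens b :=
  toOpens_inf_aux a b

instance : BoundedOrder (ZariskiLattice R) where
  top := mk [1]
  le_top a := toOpens_le_iff.1 fun p _ => (mem_toOpens_mk [1] p).2
    ⟨1, by simp, p.isPrime.one_notMem⟩
  bot := mk []
  bot_le a := toOpens_le_iff.1 fun p hp => by
    obtain ⟨f, hf, -⟩ := (mem_toOpens_mk [] p).1 hp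
    simp at hf

lemma toOpens_mono : Monotone (toOpens (R := R)) := fun _ _ h => toOpens_le_iff.2 h

lemma toOpens_bot : toOpens (⊥ : ZariskiLattice R) = ⊥ := by
  ext p
  change p ∈ toOpens (mk []) ↔ False
  simp [mem_toOpens_mk]

lemma toOpens_top : toOpens (⊤ : ZariskiLattice R) = ⊤ := by
  ext p
  change p ∈ toOpens (mk [1]) ↔ True
  simp [mem_toOpens_mk, ← Ideal.ne_top_iff_one, p.isPrime.ne_top]

lemma toOpens_finset_sup {ι : Type*} (s : Finset ι) (a : ι → ZariskiLattice R) :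
    toOpens (s.sup a) = ⨆ i ∈ s, toOpens (a i) := by
  rw [← Finset.sup_eq_iSup]
  exact Finset.apply_sup_eq_sup_comp toOpens toOpens_sup toOpens_bot

/-- `D` is a support. -/
lemma isSupport_D : IsSupport (D (R := R)) where
  map_zero := toOpens_injective (by rw [toOpens_D, toOpens_bot, PrimeSpectrum.basicOpen_zero])
  map_one := rfl
  map_mul x y := rfl
  map_add_le x y := by
    rw [← toOpens_le_iff, toOpens_sup, toOpens_D, toOpens_D, toOpens_D]
    intro p hp
    by_contra h
    change ¬ (p ∈ PrimeSpectrum.basicOpen x ∨ p ∈ PrimeSpectrum.basicOpen y) at h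
    simp only [PrimeSpectrum.mem_basicOpen, not_or, not_not] at h
    exact hp (add_mem h.1 h.2)

lemma mk_cons (f : R) (l : List R) : mk (f :: l) = D f ⊔ mk l := rfl

lemma mk_eq_foldr (l : List R) : mk l = (l.map D).foldr (· ⊔ ·) ⊥ := by
  induction l with
  | nil => rfl
  | cons f l ih => rw [mk_cons, ih]; rfl

lemma eq_sup_D (l : List R) : mk l = Finset.univ.sup fun i : Fin l.length => D (l.get i) := by
  refine toOpens_injective (SetLike.ext fun p => ?_)
  rw [mem_toOpens_mk, toOpens_finset_sup]
  simp only [Finset.mem_univ, iSup_pos, Opens.mem_iSup, toOpens_D, PrimeSpectrum.mem_basicOpen,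
    List.get_eq_getElem]
  constructor
  · rintro ⟨f, hf, hp⟩
    obtain ⟨i, hi, rfl⟩ := List.getElem_of_mem hf
    exact ⟨⟨i, hi⟩, hp⟩
  · rintro ⟨i, hi⟩
    exact ⟨_, List.getElem_mem i.2, hi⟩

lemma D_le_iff {f : R} {a : ZariskiLattice R} : D f ≤ a ↔ f ∈ toIdeal a := by
  change radicalSpan [f] ≤ toIdeal a ↔ _
  rw [radicalSpan, ← radical_toIdeal a, Ideal.radical_le_radical_iff, radical_toIdeal]
  simp [Ideal.span_le]

section Lift

variable {L : Type*} [DistribLattice L] [BoundedOrder L] {d : R → L}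

lemma support_le_of_mem_radicalSpan (hd : IsSupport d) {l : List R} {f : R}
    (hf : f ∈ radicalSpan l) : d f ≤ (l.map d).foldr (· ⊔ ·) ⊥ := by
  have key : ∀ g ∈ Ideal.span {x | x ∈ l}, d g ≤ (l.map d).foldr (· ⊔ ·) ⊥ := by
    intro g hg
    induction hg using Submodule.span_induction with
    | mem x hx =>
      clear hf
      induction l with
      | nil => simp at hx
      | cons a l ih =>
        rcases List.mem_cons.1 hx with rfl | h
        · exact le_sup_left
        · exact (ih h).trans le_sup_right
    | zero => rw [hd.map_zero]; exact bot_le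
    | add x y _ _ hx hy => exact (hd.map_add_le x y).trans (sup_le hx hy)
    | smul a x _ hx => rw [smul_eq_mul, hd.map_mul]; exact inf_le_right.trans hx
  obtain ⟨n, hn⟩ := hf
  have hpow : ∀ n : ℕ, d f ≤ d (f ^ n) := by
    intro n
    induction n with
    | zero => rw [pow_zero, hd.map_one]; exact le_top
    | succ n ih => rw [pow_succ, hd.map_mul]; exact le_inf ih le_rfl
  exact (hpow n).trans (key _ hn)

lemma foldr_le {R L : Type*} [DistribLattice L] [BoundedOrder L] (l : List R) (d : R → L) (c : L)
    (h : ∀ f ∈ l, d f ≤ c) :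
    (l.map d).foldr (· ⊔ ·) ⊥ ≤ c := by
  induction l with
  | nil => exact bot_le
  | cons a l ih => exact sup_le (h a (by simp)) (ih fun f hf => h f (by simp [hf]))

lemma mem_radicalSpan {l : List R} {f : R} (hf : f ∈ l) : f ∈ radicalSpan l :=
  Ideal.le_radical (Ideal.subset_span hf)

lemma lift_aux (hd : IsSupport d) {l l' : List R} (h : radicalSpan l ≤ radicalSpan l') :
    (l.map d).foldr (· ⊔ ·) ⊥ ≤ (l'.map d).foldr (· ⊔ ·) ⊥ :=
  foldr_le _ _ _ fun _ hf => support_le_of_mem_radicalSpan hd (h (mem_radicalSpan hf))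

/-- The underlying map of the lattice homomorphism induced by a support. -/
def liftFun (d : R → L) (hd : IsSupport d) : ZariskiLattice R → L :=
  Quotient.lift (fun l : List R => (l.map d).foldr (· ⊔ ·) ⊥) fun _ _ h =>
    le_antisymm (lift_aux hd (le_of_eq h)) (lift_aux hd (ge_of_eq h))

lemma liftFun_mk (hd : IsSupport d) (l : List R) :
    liftFun d hd (mk l) = (l.map d).foldr (· ⊔ ·) ⊥ := rfl

lemma liftFun_D (hd : IsSupport d) (f : R) : liftFun d hd (D f) = d f := sup_bot_eq (d f)

lemma liftFun_sup (hd : IsSupport d) (a b : ZariskiLattice R) :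
    liftFun d hd (a ⊔ b) = liftFun d hd a ⊔ liftFun d hd b := by
  induction a using Quotient.inductionOn with | h l => ?_
  induction b using Quotient.inductionOn with | h l' => ?_
  change liftFun d hd (mk (l ++ l')) = liftFun d hd (mk l) ⊔ liftFun d hd (mk l')
  induction l with
  | nil => exact (bot_sup_eq _).symm
  | cons f l ih =>
    change d f ⊔ liftFun d hd (mk (l ++ l')) = (d f ⊔ liftFun d hd (mk l)) ⊔ liftFun d hd (mk l')
    rw [ih, sup_assoc]

lemma liftFun_D_inf (hd : IsSupport d) (f : R) (a : ZariskiLattice R) :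
    liftFun d hd (D f ⊓ a) = liftFun d hd (D f) ⊓ liftFun d hd a := by
  induction a using Quotient.inductionOn with | h l => ?_
  change liftFun d hd (D f ⊓ mk l) = liftFun d hd (D f) ⊓ liftFun d hd (mk l)
  induction l with
  | nil =>
    change liftFun d hd (D f ⊓ ⊥) = liftFun d hd (D f) ⊓ ⊥
    rw [inf_bot_eq, inf_bot_eq]
    rfl
  | cons g l ih =>
    rw [mk_cons, inf_sup_left, liftFun_sup, liftFun_sup, ih, inf_sup_left]
    congr 1
    rw [← isSupport_D.map_mul, liftFun_D, liftFun_D, liftFun_D, hd.map_mul]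

lemma liftFun_inf (hd : IsSupport d) (a b : ZariskiLattice R) :
    liftFun d hd (a ⊓ b) = liftFun d hd a ⊓ liftFun d hd b := by
  induction a using Quotient.inductionOn with | h l => ?_
  change liftFun d hd (mk l ⊓ b) = liftFun d hd (mk l) ⊓ liftFun d hd b
  induction l with
  | nil =>
    change liftFun d hd (⊥ ⊓ b) = ⊥ ⊓ liftFun d hd b
    rw [bot_inf_eq, bot_inf_eq]
    rfl
  | cons g l ih =>
    rw [mk_cons, inf_sup_right, liftFun_sup, liftFun_sup, ih, liftFun_D_inf, inf_sup_right]

/-- The universal property of the Zariski lattice: a support `d : R → L` induces a lattice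
homomorphism with `D(f) ↦ d(f)`. -/
def lift (d : R → L) (hd : IsSupport d) : BoundedLatticeHom (ZariskiLattice R) L where
  toFun := liftFun d hd
  map_sup' := liftFun_sup hd
  map_inf' := liftFun_inf hd
  map_top' := (liftFun_D hd 1).trans hd.map_one
  map_bot' := rfl

lemma lift_D (hd : IsSupport d) (f : R) : lift d hd (D f) = d f := liftFun_D hd f

end Lift

end ZariskiLattice

/-! ### Ringed lattices -/

/-- Restriction of sections of a presheaf of rings on a poset. -/
def restr {P : Type*} [Preorder P] (F : Pᵒᵖ ⥤ CommRingCat.{u}) {v w : P} (h : v ≤ w) :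
    F.obj (op w) →+* F.obj (op v) :=
  (F.map (homOfLE h).op).hom

lemma restr_refl {P : Type*} [Preorder P] (F : Pᵒᵖ ⥤ CommRingCat.{u}) {v : P} (h : v ≤ v)
    (s : F.obj (op v)) : restr F h s = s := by
  have : (homOfLE h).op = 𝟙 (op v) := rfl
  rw [restr, this, F.map_id]
  rfl

lemma restr_restr {P : Type*} [Preorder P] (F : Pᵒᵖ ⥤ CommRingCat.{u}) {v w x : P}
    (h : v ≤ w) (h' : w ≤ x) (s : F.obj (op x)) :
    restr F h (restr F h' s) = restr F (h.trans h') s := by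
  have : (homOfLE (h.trans h')).op = (homOfLE h').op ≫ (homOfLE h).op := rfl
  rw [restr, restr, restr, this, F.map_comp]
  rfl

/-- The sheaf condition on a distributive lattice: for every finite cover `x = u₁ ⊔ … ⊔ uₙ`,
the diagram `F(x) → ∏ F(uᵢ) ⇉ ∏ F(uᵢ ⊓ uⱼ)` is an equalizer. -/
def IsLatticeSheaf {L : Type*} [DistribLattice L] [BoundedOrder L]
    (F : Lᵒᵖ ⥤ CommRingCat.{u}) : Prop :=
  ∀ (n : ℕ) (v : Fin n → L) (x : L) (hv : ∀ i, v i ≤ x), x = Finset.univ.sup v →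
    ∀ s : ∀ i, F.obj (op (v i)),
      (∀ i j, restr F (inf_le_left : v i ⊓ v j ≤ v i) (s i) =
        restr F (inf_le_right : v i ⊓ v j ≤ v j) (s j)) →
      ∃! t : F.obj (op x), ∀ i, restr F (hv i) t = s i

/-- A *ringed lattice*: a bounded distributive lattice with a sheaf of commutative rings. -/
structure RingedLattice : Type (u + 1) where
  carrier : Type u
  [distribLattice : DistribLattice carrier]
  [boundedOrder : BoundedOrder carrier]
  presheaf : carrierᵒᵖ ⥤ CommRingCat.{u}
  isSheaf : IsLatticeSheaf presheaf

namespace RingedLattice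

attribute [instance] distribLattice boundedOrder

/-- The ring of sections over `v`. -/
abbrev sec (X : RingedLattice.{u}) (v : X.carrier) : CommRingCat.{u} := X.presheaf.obj (op v)

/-- The ring of global sections. -/
abbrev Γ (X : RingedLattice.{u}) : CommRingCat.{u} := X.sec ⊤

/-- Restriction of sections. -/
abbrev res (X : RingedLattice.{u}) {v w : X.carrier} (h : v ≤ w) : X.sec w →+* X.sec v :=
  restr X.presheaf h

/-- A morphism of ringed lattices `(L, F) → (M, G)`: a lattice homomorphism `π^* : L → M` together
with a natural transformation `π^♯ : F(-) ⟶ G(π^*(-))`. -/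
structure Hom (X Y : RingedLattice.{u}) where
  base : BoundedLatticeHom X.carrier Y.carrier
  sharp (v : X.carrier) : X.sec v →+* Y.sec (base v)
  naturality {v w : X.carrier} (h : v ≤ w) (s : X.sec w) :
    sharp v (X.res h s) = Y.res (OrderHomClass.mono base h) (sharp w s)

instance : Category RingedLattice.{u} where
  Hom := Hom
  id X := ⟨BoundedLatticeHom.id _, fun _ => RingHom.id _, fun _ _ => rfl⟩
  comp f g := ⟨g.base.comp f.base, fun v => (g.sharp (f.base v)).comp (f.sharp v), fun h s => by
    change g.sharp _ (f.sharp _ _) = _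
    rw [f.naturality, g.naturality]
    rfl⟩

/-- The ring homomorphism on global sections induced by a morphism `π` (using `π^*(⊤) = ⊤`). -/
def Hom.globalSections {X Y : RingedLattice.{u}} (f : X ⟶ Y) : X.Γ →+* Y.Γ :=
  (Y.res (map_top f.base).ge).comp (f.sharp ⊤)

end RingedLattice

/-! ### Locally ringed lattices -/

/-- `v ≤ w` is an *invertibility supremum* of `s ∈ F(w)`: it is the largest element below `w` on
which `s` becomes invertible. -/
def IsInvertibilitySup {P : Type*} [Preorder P] (F : Pᵒᵖ ⥤ CommRingCat.{u}) {w : P}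
    (s : F.obj (op w)) (v : Set.Iic w) : Prop :=
  ∀ (x : P) (hx : x ≤ w), x ≤ (v : P) ↔ IsUnit (restr F hx s)

instance Set.Iic.distribLatticeOfDistribLattice {L : Type*} [DistribLattice L] (a : L) :
    DistribLattice (Set.Iic a) where
  le_sup_inf x y z := (le_sup_inf : ((x : L) ⊔ y) ⊓ (x ⊔ z) ≤ x ⊔ (y ⊓ z))

/-- A *locally ringed lattice*: a ringed lattice with an invertibility map `D` such that each
`D v : F(v) → ↓v` is a support. -/
structure LocallyRingedLattice : Type (u + 1) extends RingedLattice.{u} where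
  D (v : carrier) : presheaf.obj (op v) → Set.Iic v
  isInvertibilitySup (v : carrier) (s : presheaf.obj (op v)) : IsInvertibilitySup presheaf s (D v s)
  isSupport (v : carrier) : IsSupport (D v)

/-- A morphism of ringed lattices between locally ringed lattices *preserves invertibility
supports* if `π^*(D_v(s)) = D_{π^*(v)}(π^♯(s))`. -/
def PreservesInvertibilitySupport {X Y : LocallyRingedLattice.{u}}
    (f : X.toRingedLattice ⟶ Y.toRingedLattice) : Prop :=
  ∀ (v : X.carrier) (s : X.sec v),
    f.base (X.D v s : X.carrier) = (Y.D (f.base v) (f.sharp v s) : Y.carrier)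

namespace LocallyRingedLattice

/-- A morphism of locally ringed lattices: a morphism of ringed lattices that preserves
invertibility supports. -/
structure Hom (X Y : LocallyRingedLattice.{u}) where
  toHom : X.toRingedLattice ⟶ Y.toRingedLattice
  preserves : PreservesInvertibilitySupport toHom

instance : Category LocallyRingedLattice.{u} where
  Hom := Hom
  id X := ⟨𝟙 X.toRingedLattice, fun _ _ => rfl⟩
  comp f g := ⟨f.toHom ≫ g.toHom, fun v s => by
    change g.toHom.base (f.toHom.base _) = _
    rw [f.preserves, g.preserves]
    rfl⟩

/-- The restriction `X|_w` of a locally ringed lattice to the elements below `w`. -/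
abbrev restrict (X : LocallyRingedLattice.{u}) (w : X.carrier) : LocallyRingedLattice.{u} where
  carrier := Set.Iic w
  presheaf := (Subtype.mono_coe (· ∈ Set.Iic w)).functor.op ⋙ X.presheaf
  isSheaf n v x hv hx s hs := X.isSheaf n (fun i => (v i : X.carrier)) x hv
    (by
      rw [hx]
      exact Finset.apply_sup_eq_sup_comp (fun a : Set.Iic w => (a : X.carrier))
        (fun _ _ => rfl) rfl) s hs
  D v s := ⟨⟨X.D v s, (X.D v s).2.trans v.2⟩, (X.D v s).2⟩
  isInvertibilitySup v s x hx := X.isInvertibilitySup v s x hx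
  isSupport v :=
    let c : Set.Iic (v : X.carrier) → X.carrier := Subtype.val
    { map_zero := Subtype.ext (Subtype.ext (show c _ = c ⊥ from congrArg c (X.isSupport v).map_zero))
      map_one := Subtype.ext (Subtype.ext (show c _ = c ⊤ from congrArg c (X.isSupport v).map_one))
      map_mul := fun x y => Subtype.ext (Subtype.ext
        (show c _ = c (_ ⊓ _) from congrArg c ((X.isSupport v).map_mul x y)))
      map_add_le := fun x y => (X.isSupport v).map_add_le x y }

end LocallyRingedLattice

lemma RingedLattice.Hom.restrict_naturality_aux {X Y : RingedLattice.{u}} (f : Hom X Y)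
    (x : Y.carrier) {v v' : X.carrier} (hv : v ≤ v') (s : X.sec v') :
    Y.res (inf_le_left : f.base v ⊓ x ≤ f.base v) (f.sharp v (X.res hv s)) =
      Y.res (inf_le_inf_right x (OrderHomClass.mono f.base hv))
        (Y.res (inf_le_left : f.base v' ⊓ x ≤ f.base v') (f.sharp v' s)) := by
  rw [f.naturality, restr_restr, restr_restr]

/-- For a morphism of ringed lattices `(π^*, π^♯) : X → Y`, and `w` in `X`, `x` in `Y` with
`x ≤ π^*(w)`, the induced morphism `X|_w → Y|_x` with underlying lattice homomorphism
`v ↦ π^*(v) ⊓ x`. -/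
def RingedLattice.Hom.restrict {X Y : LocallyRingedLattice.{u}}
    (f : X.toRingedLattice ⟶ Y.toRingedLattice) (w : X.carrier) (x : Y.carrier)
    (h : x ≤ f.base w) :
    (X.restrict w).toRingedLattice ⟶ (Y.restrict x).toRingedLattice where
  base :=
    { toFun := fun v : Set.Iic w => (⟨f.base (v : X.carrier) ⊓ x, inf_le_right⟩ : Set.Iic x)
      map_sup' := fun (a b : Set.Iic w) => Subtype.ext (by
        change f.base ((a : X.carrier) ⊔ (b : X.carrier)) ⊓ x = (f.base a.1 ⊓ x) ⊔ (f.base b.1 ⊓ x)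
        rw [map_sup, inf_sup_right])
      map_inf' := fun (a b : Set.Iic w) => Subtype.ext (by
        change f.base ((a : X.carrier) ⊓ (b : X.carrier)) ⊓ x = (f.base a.1 ⊓ x) ⊓ (f.base b.1 ⊓ x)
        rw [map_inf, inf_inf_distrib_right])
      map_top' := Subtype.ext (inf_eq_right.2 h)
      map_bot' := Subtype.ext (by
        change f.base (⊥ : X.carrier) ⊓ x = (⊥ : Y.carrier)
        rw [map_bot, bot_inf_eq]) }
  sharp v := (Y.res (inf_le_left : f.base v.1 ⊓ x ≤ f.base v.1)).comp (f.sharp v.1)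
  naturality {v v'} hv s := f.restrict_naturality_aux x (v := v.1) (v' := v'.1) hv s

/-! ### The spectrum of a ring as a locally ringed lattice -/

section Spectrum

open AlgebraicGeometry ZariskiLattice

variable (R : Type u) [CommRing R]

/-- The structure sheaf of the Zariski lattice: an element is sent to the sections of the usual
structure sheaf over the corresponding quasi-compact open subset of the prime spectrum. In
particular the sections over `D(f)` are the localization `R_f`. -/
noncomputable def specPresheaf : (ZariskiLattice R)ᵒᵖ ⥤ CommRingCat.{u} :=
  (toOpens_mono (R := R)).functor.op ⋙ (Spec.structureSheaf R).obj

noncomputable instance specPresheafAlgebra (v : ZariskiLattice R) :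
    Algebra R ((specPresheaf R).obj (op v)) :=
  StructureSheaf.openAlgebra R (op (toOpens v))

lemma restr_specPresheaf_algebraMap {v w : ZariskiLattice R} (h : v ≤ w) (r : R) :
    restr (specPresheaf R) h (algebraMap R _ r) = algebraMap R _ r := rfl

lemma isLocalization_specPresheaf (f : R) :
    IsLocalization.Away f ((specPresheaf R).obj (op (ZariskiLattice.D f))) := by
  have key : ∀ U : Opens (PrimeSpectrum R), U = PrimeSpectrum.basicOpen f →
      @IsLocalization.Away R _ f ((Spec.structureSheaf R).obj.obj (op U)) _
        (StructureSheaf.openAlgebra R (op U)) := by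
    rintro _ rfl
    exact StructureSheaf.IsLocalization.to_basicOpen R f
  exact key _ (toOpens_D f)

lemma isCompatible_aux {X : TopCat.{u}} (F : TopCat.Presheaf CommRingCat.{u} X) {U V W : Opens X}
    (hW : W = U ⊓ V) (hU : W ≤ U) (hV : W ≤ V) (s : F.obj (op U)) (t : F.obj (op V))
    (h : F.map (homOfLE hU).op s = F.map (homOfLE hV).op t) :
    F.map (Opens.infLELeft U V).op s = F.map (Opens.infLERight U V).op t := by
  subst hW
  exact h

lemma specPresheaf_isSheaf : IsLatticeSheaf (specPresheaf R) := by
  intro n v x hv hx s hs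
  refine TopCat.Sheaf.existsUnique_gluing' (Spec.structureSheaf R) (fun i => toOpens (v i))
    (toOpens x) (fun i => homOfLE (toOpens_mono (hv i))) ?_ s ?_
  · rw [hx, toOpens_finset_sup]
    exact iSup_mono fun i => iSup_le fun _ => le_rfl
  · intro i j
    exact isCompatible_aux _ (toOpens_inf (v i) (v j)) (toOpens_mono inf_le_left)
      (toOpens_mono inf_le_right) _ _ (hs i j)

lemma isCompact_toOpens {R : Type*} [CommRing R] (v : ZariskiLattice R) :
    IsCompact (toOpens v : Set (PrimeSpectrum R)) := by
  induction v using Quotient.inductionOn with | h l => ?_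
  classical
  refine (PrimeSpectrum.isCompact_isOpen_iff_ideal.2 ⟨Ideal.span {x | x ∈ l},
    ⟨l.toFinset, by simp⟩, ?_⟩).1
  change _ = (PrimeSpectrum.zeroLocus (radicalSpan l : Set R))ᶜ
  rw [radicalSpan, PrimeSpectrum.zeroLocus_radical]

lemma exists_toOpens_eq {R : Type*} [CommRing R] {U : Opens (PrimeSpectrum R)}
    (hU : IsCompact (U : Set (PrimeSpectrum R))) : ∃ v : ZariskiLattice R, toOpens v = U := by
  obtain ⟨t, ht⟩ := PrimeSpectrum.isCompact_isOpen_iff.1 ⟨hU, U.isOpen⟩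
  refine ⟨mk t.toList, SetLike.ext fun p => ?_⟩
  rw [mem_toOpens_mk, ← SetLike.mem_coe, ← ht, Set.mem_compl_iff, PrimeSpectrum.mem_zeroLocus,
    Set.not_subset]
  simp

/-- The locus where a section of the structure sheaf is invertible. -/
noncomputable def invertibilityOpen (v : ZariskiLattice R) (s : (specPresheaf R).obj (op v)) :
    Opens (PrimeSpectrum R) :=
  (Spec (.of R)).basicOpen (U := toOpens v) s

lemma invertibilityOpen_le (v : ZariskiLattice R) (s : (specPresheaf R).obj (op v)) :
    invertibilityOpen R v s ≤ toOpens v :=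
  (Spec (.of R)).basicOpen_le (U := toOpens v) s

lemma exists_invertibilitySup (v : ZariskiLattice R) (s : (specPresheaf R).obj (op v)) :
    ∃ w : ZariskiLattice R, toOpens w = invertibilityOpen R v s :=
  exists_toOpens_eq (isCompact_basicOpen (Spec (.of R)) (U := toOpens v) (isCompact_toOpens v) s)

/-- The invertibility support on the Zariski lattice. -/
noncomputable def specD (v : ZariskiLattice R) (s : (specPresheaf R).obj (op v)) : Set.Iic v :=
  ⟨(exists_invertibilitySup R v s).choose,
    toOpens_le_iff.1 ((exists_invertibilitySup R v s).choose_spec.trans_le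
      (invertibilityOpen_le R v s))⟩

lemma toOpens_specD (v : ZariskiLattice R) (s : (specPresheaf R).obj (op v)) :
    toOpens (specD R v s : ZariskiLattice R) = invertibilityOpen R v s :=
  (exists_invertibilitySup R v s).choose_spec

lemma isInvertibilitySup_specD (v : ZariskiLattice R) (s : (specPresheaf R).obj (op v)) :
    IsInvertibilitySup (specPresheaf R) s (specD R v s) := by
  intro x hx
  rw [← toOpens_le_iff, toOpens_specD]
  have hres : invertibilityOpen R x (restr (specPresheaf R) hx s) =
      toOpens x ⊓ invertibilityOpen R v s :=
    (Spec (.of R)).basicOpen_res (U := toOpens v) (V := toOpens x) s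
      (homOfLE (toOpens_mono hx)).op
  constructor
  · intro h
    rw [← inf_eq_left, ← hres] at h
    refine RingedSpace.isUnit_of_isUnit_germ (Spec (.of R)).toRingedSpace (toOpens x)
      (restr (specPresheaf R) hx s) fun p hp => ?_
    exact ((Spec (.of R)).mem_basicOpen (U := toOpens x) _ p hp).1 (h.ge hp)
  · intro h
    rw [← inf_eq_left, ← hres]
    exact (Spec (.of R)).basicOpen_of_isUnit (U := toOpens x) h

lemma isSupport_specD (v : ZariskiLattice R) : IsSupport (specD R v) := by
  have inj : ∀ a b : Set.Iic v, toOpens (a : ZariskiLattice R) = toOpens (b : ZariskiLattice R) →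
    a = b := fun a b h => Subtype.ext (toOpens_injective h)
  refine ⟨inj _ _ ?_, inj _ _ ?_, fun x y => inj _ _ ?_, fun x y => ?_⟩
  · rw [toOpens_specD]
    exact ((Spec (.of R)).basicOpen_zero (toOpens v)).trans toOpens_bot.symm
  · rw [toOpens_specD]
    exact (Spec (.of R)).basicOpen_one (U := toOpens v)
  · change _ = toOpens ((specD R v x : ZariskiLattice R) ⊓ specD R v y)
    rw [toOpens_inf, toOpens_specD, toOpens_specD, toOpens_specD]
    exact (Spec (.of R)).basicOpen_mul (U := toOpens v) x y
  · change (specD R v (x + y) : ZariskiLattice R) ≤ specD R v x ⊔ specD R v y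
    refine toOpens_le_iff.1 ?_
    change _ ≤ toOpens ((specD R v x : ZariskiLattice R) ⊔ (specD R v y : ZariskiLattice R))
    rw [toOpens_sup, toOpens_specD, toOpens_specD, toOpens_specD]
    exact (Spec (.of R)).basicOpen_add_le (U := toOpens v) x y

end Spectrum

namespace LocallyRingedLattice

/-- The spectrum of a commutative ring: the Zariski lattice with its structure sheaf. -/
noncomputable abbrev Spec (R : Type u) [CommRing R] : LocallyRingedLattice.{u} where
  carrier := ZariskiLattice R
  presheaf := specPresheaf R
  isSheaf := specPresheaf_isSheaf R
  D := specD R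
  isInvertibilitySup := isInvertibilitySup_specD R
  isSupport := isSupport_specD R

/-! ### Morphisms to the spectrum induced by ring homomorphisms into the global sections -/

section ToSpec

variable {R : Type u} [CommRing R] (X : LocallyRingedLattice.{u}) (φ : R →+* X.Γ)

lemma le_D_iff {v w : X.carrier} (s : X.sec v) (h : w ≤ v) :
    w ≤ (X.D v s : X.carrier) ↔ IsUnit (X.res h s) :=
  X.isInvertibilitySup v s w h

lemma eq_of_res_eq {n : ℕ} {v : Fin n → X.carrier} {x : X.carrier} (hx : x = Finset.univ.sup v)
    (hv : ∀ i, v i ≤ x) {s t : X.sec x} (h : ∀ i, X.res (hv i) s = X.res (hv i) t) : s = t :=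
  (X.isSheaf n v x hv hx (fun i => X.res (hv i) s) fun i j => by
    rw [restr_restr, restr_restr]).unique (fun _ => rfl) fun i => (h i).symm

lemma isSupport_D_comp : IsSupport fun f : R => (X.D ⊤ (φ f) : X.carrier) := by
  have h := X.isSupport ⊤
  let c : Set.Iic (⊤ : X.carrier) → X.carrier := Subtype.val
  refine ⟨?_, ?_, fun x y => ?_, fun x y => ?_⟩
  · change c (X.D ⊤ (φ 0)) = c ⊥
    rw [map_zero, h.map_zero]
  · change c (X.D ⊤ (φ 1)) = c ⊤
    rw [map_one, h.map_one]
  · change c (X.D ⊤ (φ (x * y))) = c (_ ⊓ _)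
    rw [map_mul, h.map_mul]
  · change X.D ⊤ (φ (x + y)) ≤ X.D ⊤ (φ x) ⊔ X.D ⊤ (φ y)
    rw [map_add]
    exact h.map_add_le _ _

/-- The lattice homomorphism `𝓛_R → L_X` induced by the support `D_⊤ ∘ φ`. -/
def toSpecBase : BoundedLatticeHom (ZariskiLattice R) X.carrier :=
  ZariskiLattice.lift _ (isSupport_D_comp X φ)

lemma toSpecBase_D (f : R) :
    toSpecBase X φ (ZariskiLattice.D f) = (X.D ⊤ (φ f) : X.carrier) :=
  ZariskiLattice.lift_D _ f

lemma toSpecBase_mono {v w : ZariskiLattice R} (h : v ≤ w) :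
    toSpecBase X φ v ≤ toSpecBase X φ w := OrderHomClass.mono _ h

lemma isUnit_res_toSpecBase (f : R) :
    IsUnit (((X.res (le_top : toSpecBase X φ (ZariskiLattice.D f) ≤ ⊤)).comp φ) f) :=
  (le_D_iff X (φ f) le_top).1 (toSpecBase_D X φ f).le

/-- On basic elements, `R_f → 𝒪_X(D_⊤(φ f))` is induced by the universal property of the
localization. -/
noncomputable def toSpecBasic (f : R) :
    (specPresheaf R).obj (op (ZariskiLattice.D f)) →+* X.sec (toSpecBase X φ (ZariskiLattice.D f)) :=
  haveI := isLocalization_specPresheaf R f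
  IsLocalization.Away.lift f (isUnit_res_toSpecBase X φ f)

/-- The canonical homomorphism from `R` to the sections over `v`. -/
noncomputable def ofRing (v : ZariskiLattice R) : R →+* (specPresheaf R).obj (op v) :=
  algebraMap R ((specPresheaf R).obj (op v))

lemma res_ofRing {v w : ZariskiLattice R} (h : v ≤ w) (r : R) :
    restr (specPresheaf R) h (ofRing w r) = ofRing v r := rfl

lemma toSpecBasic_ofRing (f r : R) :
    toSpecBasic X φ f (ofRing _ r) = X.res le_top (φ r) :=
  haveI := isLocalization_specPresheaf R f
  IsLocalization.Away.lift_eq f (isUnit_res_toSpecBase X φ f) r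

lemma ringHom_ext_basic {A : Type*} [CommRing A] {f : R}
    {g g' : (specPresheaf R).obj (op (ZariskiLattice.D f)) →+* A}
    (h : ∀ r, g (ofRing _ r) = g' (ofRing _ r)) : g = g' :=
  haveI := isLocalization_specPresheaf R f
  IsLocalization.ringHom_ext (Submonoid.powers f) (RingHom.ext h)

lemma res_toSpecBasic {f g : R} (h : ZariskiLattice.D g ≤ ZariskiLattice.D f)
    (s : (specPresheaf R).obj (op (ZariskiLattice.D f))) :
    X.res (toSpecBase_mono X φ h) (toSpecBasic X φ f s) =
      toSpecBasic X φ g (restr (specPresheaf R) h s) := by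
  refine RingHom.congr_fun (f := (X.res (toSpecBase_mono X φ h)).comp (toSpecBasic X φ f))
    (g := (toSpecBasic X φ g).comp (restr (specPresheaf R) h)) (ringHom_ext_basic fun r => ?_) s
  rw [RingHom.comp_apply, RingHom.comp_apply, res_ofRing, toSpecBasic_ofRing, toSpecBasic_ofRing,
    restr_restr]

/-- `t` is the image of the section `s` under the morphism to the spectrum: this is determined on
basic elements. -/
def IsToSpecImage {v : ZariskiLattice R} (s : (specPresheaf R).obj (op v))
    (t : X.sec (toSpecBase X φ v)) : Prop :=
  ∀ (f : R) (h : ZariskiLattice.D f ≤ v),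
    X.res (toSpecBase_mono X φ h) t = toSpecBasic X φ f (restr (specPresheaf R) h s)

lemma exists_cover (v : ZariskiLattice R) :
    ∃ (n : ℕ) (f : Fin n → R), v = Finset.univ.sup fun i => ZariskiLattice.D (f i) := by
  induction v using Quotient.inductionOn with | h l => ?_
  exact ⟨l.length, l.get, ZariskiLattice.eq_sup_D l⟩

lemma toSpecBase_cover {n : ℕ} {f : Fin n → R} {v : ZariskiLattice R}
    (hv : v = Finset.univ.sup fun i => ZariskiLattice.D (f i)) :
    toSpecBase X φ v = Finset.univ.sup fun i => toSpecBase X φ (ZariskiLattice.D (f i)) := by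
  rw [hv]
  exact map_finset_sup _ _ _

lemma inf_cover {n : ℕ} {v : Fin n → X.carrier} {x w : X.carrier} (hx : x = Finset.univ.sup v)
    (hw : w ≤ x) : w = Finset.univ.sup fun i => w ⊓ v i := by
  rw [← Finset.sup_inf_distrib_left, ← hx, inf_eq_left.2 hw]

lemma existsUnique_toSpecImage {v : ZariskiLattice R} (s : (specPresheaf R).obj (op v)) :
    ∃! t : X.sec (toSpecBase X φ v), IsToSpecImage X φ s t := by
  obtain ⟨n, f, hv⟩ := exists_cover v
  have hle : ∀ i, ZariskiLattice.D (f i) ≤ v := fun i => by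
    rw [hv]
    exact Finset.le_sup (f := fun i => ZariskiLattice.D (f i)) (Finset.mem_univ i)
  have hcov := toSpecBase_cover X φ hv
  have hprod : ∀ a b : R, toSpecBase X φ (ZariskiLattice.D (a * b)) =
      toSpecBase X φ (ZariskiLattice.D a) ⊓ toSpecBase X φ (ZariskiLattice.D b) := fun a b => by
    rw [ZariskiLattice.isSupport_D.map_mul, map_inf]
  have hl : ∀ a b : R, ZariskiLattice.D (a * b) ≤ ZariskiLattice.D a := fun a b => by
    rw [ZariskiLattice.isSupport_D.map_mul]; exact inf_le_left
  have hr : ∀ a b : R, ZariskiLattice.D (a * b) ≤ ZariskiLattice.D b := fun a b => by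
    rw [ZariskiLattice.isSupport_D.map_mul]; exact inf_le_right
  obtain ⟨t, ht, -⟩ := X.isSheaf n (fun i => toSpecBase X φ (ZariskiLattice.D (f i)))
    (toSpecBase X φ v) (fun i => toSpecBase_mono X φ (hle i)) hcov
    (fun i => toSpecBasic X φ (f i) (restr (specPresheaf R) (hle i) s)) (by
      intro i j
      have hp := (hprod (f i) (f j)).ge
      have e1 := congrArg (X.res hp) (res_toSpecBasic X φ (hl (f i) (f j))
        (restr (specPresheaf R) (hle i) s))
      have e2 := congrArg (X.res hp) (res_toSpecBasic X φ (hr (f i) (f j))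
        (restr (specPresheaf R) (hle j) s))
      rw [restr_restr, restr_restr] at e1 e2
      exact e1.trans e2.symm)
  refine ⟨t, fun g hg => ?_, fun t' ht' => ?_⟩
  · refine eq_of_res_eq X (inf_cover X hcov (toSpecBase_mono X φ hg)) (fun i => inf_le_left)
      fun i => ?_
    have hp := (hprod g (f i)).ge
    have e1 := congrArg (X.res hp) (res_toSpecBasic X φ (hl g (f i)) (restr (specPresheaf R) hg s))
    have e2 := congrArg (X.res hp) (res_toSpecBasic X φ (hr g (f i)) (restr (specPresheaf R) (hle i) s))
    rw [restr_restr, restr_restr] at e1 e2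
    rw [e1, ← e2, restr_restr, ← ht i, restr_restr]
  · refine eq_of_res_eq X hcov (fun i => toSpecBase_mono X φ (hle i)) fun i => ?_
    rw [ht i, ht' _ (hle i)]

/-- The ring homomorphism `𝒪_R(v) → 𝒪_X(π^*(v))`. -/
noncomputable def toSpecSharp (v : ZariskiLattice R) :
    (specPresheaf R).obj (op v) →+* X.sec (toSpecBase X φ v) :=
  have spec := fun s : (specPresheaf R).obj (op v) => (existsUnique_toSpecImage X φ s).choose_spec.1
  have uniq := fun (s : (specPresheaf R).obj (op v)) t (ht : IsToSpecImage X φ s t) =>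
    (existsUnique_toSpecImage X φ s).unique (existsUnique_toSpecImage X φ s).choose_spec.1 ht
  { toFun := fun s => (existsUnique_toSpecImage X φ s).choose
    map_one' := uniq _ _ fun f h => by simp only [map_one]
    map_zero' := uniq _ _ fun f h => by simp only [map_zero]
    map_mul' := fun s t => uniq _ _ fun f h => by
      simp only [map_mul]
      rw [spec s f h, spec t f h]
    map_add' := fun s t => uniq _ _ fun f h => by
      simp only [map_add]
      rw [spec s f h, spec t f h] }

lemma isToSpecImage_toSpecSharp {v : ZariskiLattice R} (s : (specPresheaf R).obj (op v)) :
    IsToSpecImage X φ s (toSpecSharp X φ v s) :=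
  (existsUnique_toSpecImage X φ s).choose_spec.1

lemma toSpecSharp_naturality {v w : ZariskiLattice R} (h : v ≤ w)
    (s : (specPresheaf R).obj (op w)) :
    toSpecSharp X φ v (restr (specPresheaf R) h s) =
      X.res (toSpecBase_mono X φ h) (toSpecSharp X φ w s) := by
  refine (existsUnique_toSpecImage X φ (restr (specPresheaf R) h s)).unique
    (isToSpecImage_toSpecSharp X φ _) fun f hf => ?_
  rw [restr_restr, restr_restr]
  exact isToSpecImage_toSpecSharp X φ s f (hf.trans h)

/-- The morphism of ringed lattices `𝓛_R → L_X` induced by `φ : R → 𝒪_X(⊤)`. -/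
noncomputable def toSpecHom : (Spec R).toRingedLattice ⟶ X.toRingedLattice where
  base := toSpecBase X φ
  sharp := toSpecSharp X φ
  naturality h s := toSpecSharp_naturality X φ h s

lemma toSpecBase_specD (v : ZariskiLattice R) (s : (specPresheaf R).obj (op v)) :
    toSpecBase X φ (specD R v s : ZariskiLattice R) =
      (X.D (toSpecBase X φ v) (toSpecSharp X φ v s) : X.carrier) := by
  have hD := isInvertibilitySup_specD R v s
  apply le_antisymm
  · have hle : (specD R v s : ZariskiLattice R) ≤ v := (specD R v s).2
    refine (le_D_iff X _ (toSpecBase_mono X φ hle)).2 ?_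
    rw [← toSpecSharp_naturality X φ hle s]
    exact ((hD _ hle).1 le_rfl).map _
  · obtain ⟨n, f, hv⟩ := exists_cover v
    have hle : ∀ i, ZariskiLattice.D (f i) ≤ v := fun i => by
      rw [hv]
      exact Finset.le_sup (f := fun i => ZariskiLattice.D (f i)) (Finset.mem_univ i)
    set t := toSpecSharp X φ v s with ht
    have hw : (X.D (toSpecBase X φ v) t : X.carrier) ≤ toSpecBase X φ v := (X.D _ t).2
    rw [inf_cover X (toSpecBase_cover X φ hv) hw]
    refine Finset.sup_le fun i _ => ?_
    set w := (X.D (toSpecBase X φ v) t : X.carrier) ⊓ toSpecBase X φ (ZariskiLattice.D (f i))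
      with hwdef
    have hwD : w ≤ toSpecBase X φ (ZariskiLattice.D (f i)) := inf_le_right
    have hwt : IsUnit (X.res (inf_le_left.trans hw : w ≤ _) t) :=
      (le_D_iff X t _).1 inf_le_left
    have hloc := isLocalization_specPresheaf R (f i)
    obtain ⟨⟨r, ⟨_, k, rfl⟩⟩, hr⟩ := IsLocalization.surj (Submonoid.powers (f i))
      (S := (specPresheaf R).obj (op (ZariskiLattice.D (f i))))
      (restr (specPresheaf R) (hle i) s)
    replace hr : restr (specPresheaf R) (hle i) s * ofRing _ (f i ^ k) = ofRing _ r := hr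
    have hwr : IsUnit (X.res (le_top : w ≤ ⊤) (φ r)) := by
      have h1 := congrArg (toSpecBasic X φ (f i)) hr
      rw [map_mul, toSpecBasic_ofRing, toSpecBasic_ofRing,
        ← isToSpecImage_toSpecSharp X φ s (f i) (hle i), ← ht] at h1
      have h2 := congrArg (X.res hwD) h1
      rw [map_mul, restr_restr, restr_restr, restr_restr] at h2
      rw [← h2, map_pow, map_pow]
      exact hwt.mul (((le_D_iff X (φ (f i)) le_top).1 (hwD.trans (toSpecBase_D X φ _).le)).pow k)
    have hle' : ZariskiLattice.D (f i) ⊓ ZariskiLattice.D r ≤ (specD R v s : ZariskiLattice R) := by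
      rw [← ZariskiLattice.isSupport_D.map_mul]
      have hfr : ZariskiLattice.D (f i * r) ≤ ZariskiLattice.D (f i) := by
        rw [ZariskiLattice.isSupport_D.map_mul]; exact inf_le_left
      refine (hD _ (hfr.trans (hle i))).2 ?_
      have h1 := congrArg (restr (specPresheaf R) hfr) hr
      rw [map_mul, restr_restr, res_ofRing, res_ofRing] at h1
      have h2 : IsUnit (ofRing (ZariskiLattice.D (f i * r)) (f i * r)) :=
        haveI := isLocalization_specPresheaf R (f i * r)
        IsLocalization.Away.algebraMap_isUnit (f i * r)
      rw [map_mul] at h2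
      have h3 := isUnit_of_mul_isUnit_right h2
      rw [← h1] at h3
      exact isUnit_of_mul_isUnit_left h3
    refine le_trans (le_trans ?_ (map_inf (toSpecBase X φ) _ _).ge) (toSpecBase_mono X φ hle')
    exact le_inf hwD (((le_D_iff X (φ r) le_top).2 hwr).trans (toSpecBase_D X φ r).ge)

/-- The morphism of locally ringed lattices `Spec(R) → X` (a morphism from `X` to `Spec(R)` in the
opposite category) induced by a ring homomorphism `φ : R → 𝒪_X(⊤)`. -/
noncomputable def toSpec : Spec R ⟶ X where
  toHom := toSpecHom X φ
  preserves := toSpecBase_specD X φ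

end ToSpec

/-- The action of `Spec` on ring homomorphisms: `D(f) ↦ D(φ(f))` on Zariski lattices, and
`R_f → A_{φ(f)}` on the structure sheaves. -/
noncomputable def Spec.map {R A : Type u} [CommRing R] [CommRing A] (φ : R →+* A) :
    Spec R ⟶ Spec A :=
  toSpec (Spec A) ((ofRing ⊤).comp φ)

/-- The canonical morphism `η_X` between `X` and the spectrum of its ring of global sections. -/
noncomputable def η (X : LocallyRingedLattice.{u}) : Spec X.Γ ⟶ X :=
  toSpec X (RingHom.id X.Γ)

/-- `X` is an *affine scheme* if `η_X` is an isomorphism of locally ringed lattices. -/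
def IsAffine (X : LocallyRingedLattice.{u}) : Prop := IsIso (η X)

/-- `u₁, …, uₙ` is an affine cover of `X`: `⊤ = u₁ ⊔ … ⊔ uₙ` and each `X|_{uᵢ}` is affine. -/
structure IsAffineCover (X : LocallyRingedLattice.{u}) {n : ℕ} (v : Fin n → X.carrier) : Prop where
  cover : ⊤ = Finset.univ.sup v
  affine : ∀ i, (X.restrict (v i)).IsAffine

/-- `X` is a *qcqs-scheme* if it has a finite affine cover. -/
def IsQcqsScheme (X : LocallyRingedLattice.{u}) : Prop :=
  ∃ (n : ℕ) (v : Fin n → X.carrier), X.IsAffineCover v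

/-- A morphism of ringed lattices `π`, given by `π^* : L_Y → L_X` and `π^♯ : 𝒪_Y → π_*𝒪_X`, is
*locally affine* if there are affine covers `u₁, …, uₙ` of `X` and `w₁, …, wₘ` of `Y` such that
for each `uᵢ` there is a `wⱼ` with `uᵢ ≤ π^*(wⱼ)` for which the induced morphism
between `X|_{uᵢ}` and `Y|_{wⱼ}` is identified, via `η`, with `Spec` applied to the induced ring
homomorphism `𝒪_Y(wⱼ) → 𝒪_X(uᵢ)`. -/
def IsLocallyAffine {X Y : LocallyRingedLattice.{u}}
    (π : Y.toRingedLattice ⟶ X.toRingedLattice) : Prop :=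
  ∃ (n : ℕ) (v : Fin n → X.carrier) (m : ℕ) (w : Fin m → Y.carrier),
    X.IsAffineCover v ∧ Y.IsAffineCover w ∧
      ∀ i, ∃ (j : Fin m) (h : v i ≤ π.base (w j)),
        (η (Y.restrict (w j))).toHom ≫ RingedLattice.Hom.restrict π (w j) (v i) h =
          (Spec.map (RingedLattice.Hom.restrict π (w j) (v i) h).globalSections).toHom ≫
            (η (X.restrict (v i))).toHom

end LocallyRingedLattice

/-! ### Comparing morphisms of ringed lattices. -/

namespace RingedLattice

/-! Preservation of invertibility supports is a local property. The inequality π^*(D(s)) ≤ D(π^♯(s))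
holds for every morphism of ringed lattices, since ring homomorphisms preserve units, and the
reverse one can be cut along a cover of `X` (`preserves_of_restrict`).

If π is locally affine, then on each piece the composite of η of an affine `Y|_w` with the
restricted π equals a composite of morphisms of locally ringed lattices. This η is an isomorphism,
so it can be cancelled and the restricted π preserves supports (`preserves_of_η_comp_eq`).

Conversely, the equation defining local affineness is the naturality square of η, and it holds for
every support-preserving morphism (`η_naturality`): a morphism out of a spectrum is determined by
its values on the D(f) and on the elements of the ring (`specHom_ext`). What remains is to find the
covers. An arbitrary affine cover of `Y` pulls back to a cover of `X`, which must be refined to an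
affine one (`exists_affine_refinement`). This works because the elements below an affine element are
finite joins of its basic elements, and these are again affine (`IsAffineElement.of_D`).

To prove the latter, affineness of `X|_v` is spelled out inside `X` by `IsAffineElement`. Its four
conditions express, in order, that η is surjective and injective on lattices, and surjective and
injective on sections over basic elements. Passing from `v` to D(f) is then a matter of clearing
denominators, and `isAffine_restrict_iff` translates back. The last two conditions speak of any `x`
equal to D(f), so that they can be used along propositional equalities without casts. -/

lemma Hom.ext_of_eq {X Y : RingedLattice.{u}} {f g : X ⟶ Y} (hb : ∀ v, f.base v = g.base v)
    (hs : ∀ v s, f.sharp v s = Y.res (hb v).le (g.sharp v s)) : f = g := by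
  obtain ⟨fb, fs, hf⟩ := f
  obtain ⟨gb, gs, hg⟩ := g
  obtain rfl : fb = gb := DFunLike.ext _ _ hb
  obtain rfl : fs = gs := by
    funext v
    ext s
    exact (hs v s).trans (restr_refl _ _ _)
  rfl

/-- The two values lie over elements that are only propositionally equal; restriction along the
inequality plays the role of a cast and composes by `restr_restr`. -/
lemma Hom.sharp_congr {X Y : RingedLattice.{u}} {f g : X ⟶ Y} (h : f = g) (v : X.carrier)
    (s : X.sec v) (hb : f.base v ≤ g.base v) : f.sharp v s = Y.res hb (g.sharp v s) := by
  subst h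
  exact (restr_refl _ _ _).symm

end RingedLattice

namespace LocallyRingedLattice

/-! ### Calculus of invertibility supports. -/

section Invertibility

variable (X : LocallyRingedLattice.{u})

lemma D_le {v : X.carrier} (s : X.sec v) : (X.D v s : X.carrier) ≤ v := (X.D v s).2

/-- Both sides are the largest element below `w` on which `s` becomes invertible. -/
lemma D_res {v w : X.carrier} (h : w ≤ v) (s : X.sec v) :
    (X.D w (X.res h s) : X.carrier) = (X.D v s : X.carrier) ⊓ w := by
  refine le_antisymm (le_inf ?_ (D_le X _)) ?_
  · have h1 := (le_D_iff X (X.res h s) (D_le X (X.res h s))).1 le_rfl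
    rw [restr_restr] at h1
    exact (le_D_iff X s _).2 h1
  · refine (le_D_iff X _ inf_le_right).2 ?_
    rw [restr_restr]
    exact (le_D_iff X s _).1 inf_le_left

lemma D_mul {v : X.carrier} (s t : X.sec v) :
    (X.D v (s * t) : X.carrier) = (X.D v s : X.carrier) ⊓ X.D v t :=
  congrArg Subtype.val ((X.isSupport v).map_mul s t)

lemma D_of_isUnit {v : X.carrier} {s : X.sec v} (hs : IsUnit s) : (X.D v s : X.carrier) = v :=
  le_antisymm (D_le X s) ((le_D_iff X s le_rfl).2 (hs.map _))

lemma isUnit_res_D {v : X.carrier} (s : X.sec v) : IsUnit (X.res (D_le X s) s) :=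
  (le_D_iff X s (D_le X s)).1 le_rfl

end Invertibility

/-! ### Isomorphisms as bijective morphisms. -/

section Isomorphisms

variable {X Y : LocallyRingedLattice.{u}}

lemma congr_toHom {F G : X ⟶ Y} (h : F.toHom = G.toHom) : F = G := by
  obtain ⟨F, hF⟩ := F
  obtain ⟨G, hG⟩ := G
  obtain rfl : F = G := h
  rfl

lemma base_bijective_of_isIso (F : X ⟶ Y) [IsIso F] : Function.Bijective F.toHom.base := by
  have h1 : F.toHom ≫ (inv F).toHom = 𝟙 _ := congrArg Hom.toHom (IsIso.hom_inv_id F)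
  have h2 : (inv F).toHom ≫ F.toHom = 𝟙 _ := congrArg Hom.toHom (IsIso.inv_hom_id F)
  exact Function.bijective_iff_has_inverse.2 ⟨(inv F).toHom.base,
    fun v => DFunLike.congr_fun (congrArg RingedLattice.Hom.base h1) v,
    fun v => DFunLike.congr_fun (congrArg RingedLattice.Hom.base h2) v⟩

/-- The two composites with the sheaf part of the inverse are restrictions along equalities of
lattice elements, and such restrictions are themselves bijective. -/
lemma sharp_bijective_of_isIso (F : X ⟶ Y) [IsIso F] (v : X.carrier) :
    Function.Bijective (F.toHom.sharp v) := by
  have h1 : F.toHom ≫ (inv F).toHom = 𝟙 _ := congrArg Hom.toHom (IsIso.hom_inv_id F)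
  have h2 : (inv F).toHom ≫ F.toHom = 𝟙 _ := congrArg Hom.toHom (IsIso.inv_hom_id F)
  have b1 : ∀ v, (inv F).toHom.base (F.toHom.base v) = v :=
    fun v => DFunLike.congr_fun (congrArg RingedLattice.Hom.base h1) v
  constructor
  · intro s t hst
    have e : ∀ s, (inv F).toHom.sharp _ (F.toHom.sharp v s) = X.res (b1 v).le s := fun s =>
      RingedLattice.Hom.sharp_congr h1 v s (b1 v).le
    have h3 := congrArg (X.res (b1 v).ge) ((e s).symm.trans ((congrArg _ hst).trans (e t)))
    rwa [restr_restr, restr_restr, restr_refl, restr_refl] at h3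
  · intro t
    refine ⟨X.res (b1 v).ge ((inv F).toHom.sharp _ t), ?_⟩
    rw [F.toHom.naturality]
    have h3 : F.toHom.sharp _ ((inv F).toHom.sharp _ t) =
        Y.res (congrArg F.toHom.base (b1 v)).le t :=
      RingedLattice.Hom.sharp_congr h2 _ t _
    rw [h3, restr_restr, restr_refl]

/-- The inverse of a morphism of ringed lattices that is bijective on lattices and sections. -/
noncomputable def inverse (F : X.toRingedLattice ⟶ Y.toRingedLattice)
    (hb : Function.Bijective F.base)
    (hs : ∀ v, Function.Bijective (F.sharp v)) : Y.toRingedLattice ⟶ X.toRingedLattice :=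
  let e := Equiv.ofBijective _ hb
  have he : ∀ y, F.base (e.symm y) = y := e.apply_symm_apply
  -- A bijective homomorphism reflects the order, because the order is expressed by meets.
  have hmono : ∀ {a b}, a ≤ b → e.symm a ≤ e.symm b := fun {a b} h => by
    rw [← inf_eq_left] at h ⊢
    exact hb.1 (by rw [map_inf, he, he, h])
  { base :=
      { toFun := e.symm
        map_sup' := fun a b => hb.1 ((he _).trans (by rw [map_sup, he, he]))
        map_inf' := fun a b => hb.1 ((he _).trans (by rw [map_inf, he, he]))
        map_top' := hb.1 ((he _).trans (map_top F.base).symm)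
        map_bot' := hb.1 ((he _).trans (map_bot F.base).symm) }
    sharp := fun v => ((RingEquiv.ofBijective _ (hs (e.symm v))).symm : _ →+* _).comp
      (Y.res (he v).le)
    naturality := fun {v w} h s => (hs (e.symm v)).1 (by
      have h1 : ∀ v t, F.sharp (e.symm v) ((RingEquiv.ofBijective _ (hs (e.symm v))).symm t) = t :=
        fun v t => (RingEquiv.ofBijective _ (hs (e.symm v))).apply_symm_apply t
      change F.sharp (e.symm v) ((RingEquiv.ofBijective _ (hs (e.symm v))).symm _) =
        F.sharp (e.symm v) (X.res (hmono h)
          ((RingEquiv.ofBijective _ (hs (e.symm w))).symm (Y.res _ s)))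
      rw [h1, F.naturality, h1, restr_restr, restr_restr]) }

/-- The inverse preserves supports automatically: by injectivity this can be checked after applying
`F`, which preserves them. -/
lemma isIso_of_bijective (F : X ⟶ Y) (hb : Function.Bijective F.toHom.base)
    (hs : ∀ v, Function.Bijective (F.toHom.sharp v)) : IsIso F := by
  have he : ∀ y, F.toHom.base ((inverse F.toHom hb hs).base y) = y :=
    (Equiv.ofBijective _ hb).apply_symm_apply
  have hes : ∀ v s, F.toHom.sharp _ ((inverse F.toHom hb hs).sharp v s) = Y.res (he v).le s :=
    fun v s => (RingEquiv.ofBijective _ (hs _)).apply_symm_apply _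
  have hpres : PreservesInvertibilitySupport (inverse F.toHom hb hs) := fun v s => hb.1 (by
    rw [he, F.preserves, hes, D_res, he, inf_eq_left.2 (Y.D v s).2])
  refine ⟨⟨inverse F.toHom hb hs, hpres⟩, ?_, ?_⟩
  · refine congr_toHom ?_
    refine RingedLattice.Hom.ext_of_eq (fun v => hb.1 (he _)) fun v s => (hs _).1 ?_
    change F.toHom.sharp _ ((inverse F.toHom hb hs).sharp _ (F.toHom.sharp v s)) =
      F.toHom.sharp _ (X.res _ s)
    have hle : (inverse F.toHom hb hs).base (F.toHom.base v) ≤ v := (hb.1 (he _)).le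
    exact (hes _ _).trans (F.toHom.naturality hle s).symm
  · refine congr_toHom ?_
    exact RingedLattice.Hom.ext_of_eq he hes

end Isomorphisms

/-! ### Morphisms out of a spectrum. -/

section SpecHom

variable {R : Type u} [CommRing R] {X : LocallyRingedLattice.{u}}

/-- Morphisms of ringed lattices out of a spectrum are determined on basic elements and on
elements of the ring. -/
lemma specHom_ext {F G : (Spec R).toRingedLattice ⟶ X.toRingedLattice}
    (hb : ∀ f : R, F.base (ZariskiLattice.D f) = G.base (ZariskiLattice.D f))
    (hs : ∀ r : R, F.sharp ⊤ (ofRing ⊤ r) =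
      X.res ((map_top F.base).trans (map_top G.base).symm).le (G.sharp ⊤ (ofRing ⊤ r))) :
    F = G := by
  have hbase : ∀ v : ZariskiLattice R, F.base v = G.base v := fun v => by
    obtain ⟨n, f, hv⟩ := exists_cover v
    rw [hv]
    refine (map_finset_sup F.base _ _).trans ((map_finset_sup G.base _ _).trans ?_).symm
    exact Finset.sup_congr rfl fun i _ => (hb (f i)).symm
  refine RingedLattice.Hom.ext_of_eq hbase fun v s => ?_
  obtain ⟨n, f, hv⟩ := exists_cover (v : ZariskiLattice R)
  have hle : ∀ i, ZariskiLattice.D (f i) ≤ v := fun i => by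
    rw [hv]
    exact Finset.le_sup (f := fun i => ZariskiLattice.D (f i)) (Finset.mem_univ i)
  have hcov : F.base v = Finset.univ.sup fun i => F.base (ZariskiLattice.D (f i)) := by
    rw [hv]
    exact map_finset_sup _ _ _
  refine eq_of_res_eq X hcov (fun i => OrderHomClass.mono F.base (hle i)) fun i => ?_
  -- Both sides are ring homomorphisms out of the localization at `f i`, hence determined on `R`;
  -- naturality carries the hypothesis at ⊤ down to the basic element.
  have key : F.sharp (ZariskiLattice.D (f i)) =
      (X.res (hb (f i)).le).comp (G.sharp (ZariskiLattice.D (f i))) :=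
    ringHom_ext_basic fun r => by
      have h1 := F.naturality (le_top : ZariskiLattice.D (f i) ≤ ⊤) (ofRing ⊤ r)
      have h2 := G.naturality (le_top : ZariskiLattice.D (f i) ≤ ⊤) (ofRing ⊤ r)
      have h3 : F.sharp (ZariskiLattice.D (f i)) (ofRing _ r) = _ := h1
      have h4 : G.sharp (ZariskiLattice.D (f i)) (ofRing _ r) = _ := h2
      rw [RingHom.comp_apply, h3, h4, hs, restr_restr, restr_restr]
  have h1 := F.naturality (hle i) s
  have h2 := G.naturality (hle i) s
  rw [key, RingHom.comp_apply, h2, restr_restr] at h1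
  rw [← h1, restr_restr]

/-- A morphism of ringed lattices out of a spectrum is bijective on sections if it is so on basic
elements. -/
lemma specHom_sharp_bijective {F : (Spec R).toRingedLattice ⟶ X.toRingedLattice}
    (h : ∀ f : R, Function.Bijective (F.sharp (ZariskiLattice.D f))) (v : ZariskiLattice R) :
    Function.Bijective (F.sharp v) := by
  obtain ⟨n, f, hv⟩ := exists_cover v
  have hle : ∀ i, ZariskiLattice.D (f i) ≤ v := fun i => by
    rw [hv]
    exact Finset.le_sup (f := fun i => ZariskiLattice.D (f i)) (Finset.mem_univ i)
  have hcov : F.base v = Finset.univ.sup fun i => F.base (ZariskiLattice.D (f i)) := by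
    rw [hv]
    exact map_finset_sup _ _ _
  have hmono : ∀ {a b : ZariskiLattice R}, a ≤ b → F.base a ≤ F.base b :=
    fun h => OrderHomClass.mono F.base h
  constructor
  · intro s t hst
    refine eq_of_res_eq (Spec R) hv hle fun i => (h (f i)).1 ?_
    rw [F.naturality, F.naturality, hst]
  · intro t
    choose s hs using fun i => (h (f i)).2 (X.res (hmono (hle i)) t)
    -- The overlap of two basic elements is by definition the basic element of the product, so
    -- injectivity there makes the local preimages agree and they glue.
    obtain ⟨s', hs', -⟩ := specPresheaf_isSheaf R n (fun i => ZariskiLattice.D (f i)) v hle hv s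
      fun i j => (h (f i * f j)).1 (by
        have h1 := F.naturality (inf_le_left : ZariskiLattice.D (f i) ⊓ ZariskiLattice.D (f j) ≤ _)
          (s i)
        have h2 := F.naturality (inf_le_right : ZariskiLattice.D (f i) ⊓ ZariskiLattice.D (f j) ≤ _)
          (s j)
        rw [hs, restr_restr] at h1 h2
        exact h1.trans h2.symm)
    refine ⟨s', eq_of_res_eq X hcov (fun i => hmono (hle i)) fun i => ?_⟩
    rw [← F.naturality (hle i) s', ← hs i]
    exact congrArg _ (hs' i)

end SpecHom

/-! ### Affine elements and their basic elements. -/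

/-- An intrinsic description of the elements `v` of `X` such that `X|_v` is affine. -/
structure IsAffineElement (X : LocallyRingedLattice.{u}) (v : X.carrier) : Prop where
  exists_eq_sup : ∀ x ≤ v, ∃ (n : ℕ) (g : Fin n → X.sec v),
    x = Finset.univ.sup fun i => (X.D v (g i) : X.carrier)
  mem_radical : ∀ (f : X.sec v) (n : ℕ) (g : Fin n → X.sec v),
    (X.D v f : X.carrier) ≤ (Finset.univ.sup fun i => (X.D v (g i) : X.carrier)) →
      f ∈ (Ideal.span (Set.range g)).radical
  exists_res_eq : ∀ (f : X.sec v) (x : X.carrier) (hx : x ≤ v), x = X.D v f → ∀ t : X.sec x,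
    ∃ (n : ℕ) (r : X.sec v), X.res hx r = X.res hx f ^ n * t
  exists_pow_mul_eq_zero : ∀ (f : X.sec v) (x : X.carrier) (hx : x ≤ v), x = X.D v f →
    ∀ r : X.sec v, X.res hx r = 0 → ∃ n : ℕ, f ^ n * r = 0

namespace IsAffineElement

variable {X : LocallyRingedLattice.{u}} {v : X.carrier}

/-- Clearing denominators: `f` is a unit on D(f), so the power of `f` multiplying `t` counts as a
unit. -/
lemma exists_unit_mul (hv : X.IsAffineElement v) (f : X.sec v) (t : X.sec (X.D v f)) :
    ∃ (r : X.sec v) (a : (X.sec (X.D v f) : Type u)ˣ), X.res (X.D_le f) r = a * t := by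
  obtain ⟨n, r, hr⟩ := hv.exists_res_eq f _ (X.D_le f) rfl t
  exact ⟨r, ((X.isUnit_res_D f).pow n).unit, hr⟩

/-- Turns basic elements of D(f) into basic elements of `v`: the unit does not change the support,
and restricting to D(f) means meeting with D(f), which accounts for the factor `f`. -/
lemma D_eq_of_res_eq {f : X.sec v} {t : X.sec (X.D v f)}
    {r : X.sec v} {a : (X.sec (X.D v f) : Type u)ˣ} (h : X.res (X.D_le f) r = a * t) :
    (X.D (X.D v f) t : X.carrier) = X.D v (r * f) := by
  have h1 : (X.D (X.D v f) (a * t : X.sec (X.D v f)) : X.carrier) = X.D (X.D v f) t := by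
    rw [D_mul, D_of_isUnit X a.isUnit, inf_eq_right.2 (D_le X t)]
  rw [← h1, ← h, D_res, D_mul]

/-- The basic elements of an affine element are affine. -/
lemma of_D (hv : X.IsAffineElement v) (f : X.sec v) : X.IsAffineElement (X.D v f) where
  exists_eq_sup x hx := by
    obtain ⟨n, g, hg⟩ := hv.exists_eq_sup x (hx.trans (X.D_le f))
    refine ⟨n, fun i => X.res (X.D_le f) (g i), ?_⟩
    simp only [D_res]
    rw [← Finset.sup_inf_distrib_right, ← hg, inf_eq_left.2 hx]
  mem_radical t n g h := by
    -- With `t` and the `g i` replaced by their numerators times `f`, the covering relation becomes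
    -- one between basic elements of `v`.
    obtain ⟨r, a, hr⟩ := hv.exists_unit_mul f t
    choose r' a' hr' using fun i => hv.exists_unit_mul f (g i)
    simp only [D_eq_of_res_eq hr, D_eq_of_res_eq (hr' _)] at h
    obtain ⟨m, hm⟩ := hv.mem_radical _ _ _ h
    have hm' : X.res (X.D_le f) (r * f) ∈ (Ideal.span (Set.range g)).radical := by
      refine ⟨m, ?_⟩
      rw [← map_pow]
      have h1 : Ideal.span (Set.range fun i => r' i * f) ≤
          (Ideal.span (Set.range g)).comap (X.res (X.D_le f)) := by
        rw [Ideal.span_le]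
        rintro _ ⟨i, rfl⟩
        change X.res (X.D_le f) (r' i * f) ∈ Ideal.span (Set.range g)
        rw [map_mul, hr' i]
        exact Ideal.mul_mem_right _ _ (Ideal.mul_mem_left _ _ (Ideal.subset_span ⟨i, rfl⟩))
      exact h1 hm
    rw [map_mul, hr, mul_right_comm] at hm'
    -- Over D(f) the numerator times `f` differs from `t` only by the unit `a` times `f`.
    rwa [← Ideal.unit_mul_mem_iff_mem _ (a.isUnit.mul (X.isUnit_res_D f))]
  exists_res_eq t x hx hxt u := by
    obtain ⟨r, a, hr⟩ := hv.exists_unit_mul f t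
    have hxv := hx.trans (X.D_le f)
    obtain ⟨n, p, hp⟩ := hv.exists_res_eq _ x hxv (hxt.trans (D_eq_of_res_eq hr)) u
    -- The condition on `v` yields powers of `r * f`, while powers of `t` are wanted; the unit `c`
    -- measures the difference, and `c ^ n` is divided out of the witness.
    obtain ⟨c, hc⟩ : ∃ c : (X.sec (X.D v f) : Type u)ˣ, X.res hxv (r * f) =
        X.res hx c * X.res hx t := by
      refine ⟨a * (X.isUnit_res_D f).unit, ?_⟩
      rw [← restr_restr _ hx (X.D_le f), map_mul, hr, Units.val_mul, IsUnit.unit_spec, ← map_mul,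
        mul_right_comm]
    have hcc : X.res hx ↑(c ^ n)⁻¹ * X.res hx c ^ n = 1 := by
      rw [← map_pow, ← map_mul, ← Units.val_pow_eq_pow_val, Units.inv_mul, map_one]
    refine ⟨n, ↑(c ^ n)⁻¹ * X.res (X.D_le f) p, ?_⟩
    rw [map_mul, restr_restr, hp, hc]
    linear_combination (X.res hx t ^ n * u) * hcc
  exists_pow_mul_eq_zero t x hx hxt p hp := by
    obtain ⟨r, a, hr⟩ := hv.exists_unit_mul f t
    obtain ⟨q, b, hq⟩ := hv.exists_unit_mul f p
    have hxv := hx.trans (X.D_le f)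
    obtain ⟨n, hn⟩ := hv.exists_pow_mul_eq_zero _ x hxv (hxt.trans (D_eq_of_res_eq hr)) q (by
      rw [← restr_restr _ hx (X.D_le f), hq, map_mul, hp, mul_zero])
    refine ⟨n, ?_⟩
    have h1 := congrArg (X.res (X.D_le f)) hn
    rw [map_mul, map_pow, map_mul, hr, hq, map_zero] at h1
    -- These are the units by which the restricted relation differs from `t ^ n * p = 0`.
    have h2 : IsUnit ((a * X.res (X.D_le f) f) ^ n * b) :=
      ((a.isUnit.mul (X.isUnit_res_D f)).pow n).mul b.isUnit
    refine (h2.mul_right_eq_zero).1 ?_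
    rw [← h1]
    ring

end IsAffineElement

/-! ### Affine elements versus affine restrictions. -/

/-- The radical is the intersection of the primes containing the ideal, so membership is the
covering of one basic open of the prime spectrum by others. -/
lemma zariskiLattice_D_le_sup_iff {R : Type u} [CommRing R] {f : R} {n : ℕ} {g : Fin n → R} :
    ZariskiLattice.D f ≤ (Finset.univ.sup fun i => ZariskiLattice.D (g i)) ↔
      f ∈ (Ideal.span (Set.range g)).radical := by
  rw [← ZariskiLattice.toOpens_le_iff, ZariskiLattice.toOpens_finset_sup,
    Ideal.radical_eq_sInf, Ideal.mem_sInf]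
  simp only [Finset.mem_univ, iSup_pos, ZariskiLattice.toOpens_D, Ideal.span_le,
    Set.range_subset_iff]
  constructor
  · rintro h J ⟨hJ, hJp⟩
    by_contra hf
    obtain ⟨i, hi⟩ := Opens.mem_iSup.1 (h (show (⟨J, hJp⟩ : PrimeSpectrum R) ∈ _ from hf))
    exact hi (hJ i)
  · intro h p hp
    by_contra hn
    refine hp (h ⟨fun i => ?_, p.isPrime⟩)
    by_contra hi
    exact hn (Opens.mem_iSup.2 ⟨i, hi⟩)

lemma toSpecSharp_D {R : Type u} [CommRing R] (X : LocallyRingedLattice.{u}) (φ : R →+* X.Γ)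
    (f r : R) : toSpecSharp X φ (ZariskiLattice.D f) (ofRing _ r) = X.res le_top (φ r) := by
  have h := isToSpecImage_toSpecSharp X φ (ofRing (ZariskiLattice.D f) r) f le_rfl
  rw [restr_refl, res_ofRing, toSpecBasic_ofRing] at h
  exact h

/-- The top of the Zariski lattice is by definition the basic element of 1. -/
lemma toSpecSharp_top {R : Type u} [CommRing R] (X : LocallyRingedLattice.{u}) (φ : R →+* X.Γ)
    (r : R) : toSpecSharp X φ ⊤ (ofRing _ r) = X.res le_top (φ r) :=
  toSpecSharp_D X φ 1 r

/-- All four conditions hold for the spectrum, by the description of its order and by localization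
at `f`, and are transported along the bijections given by η. -/
lemma IsAffine.isAffineElement_top {X : LocallyRingedLattice.{u}} (hX : X.IsAffine) :
    X.IsAffineElement ⊤ := by
  have hX : IsIso (η X) := hX
  have hb : Function.Bijective (toSpecBase X (RingHom.id X.Γ)) := base_bijective_of_isIso (η X)
  have hs : ∀ v, Function.Bijective (toSpecSharp X (RingHom.id X.Γ) v) :=
    sharp_bijective_of_isIso (η X)
  have hsup : ∀ {n : ℕ} (g : Fin n → X.Γ), toSpecBase X (RingHom.id X.Γ)
      (Finset.univ.sup fun i => ZariskiLattice.D (g i)) =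
        Finset.univ.sup fun i => (X.D ⊤ (g i) : X.carrier) := fun g => by
    rw [toSpecBase_cover X _ rfl]
    simp only [toSpecBase_D, RingHom.id_apply]
  have hD : ∀ f : X.Γ, toSpecBase X (RingHom.id X.Γ) (ZariskiLattice.D f) = X.D ⊤ f := fun f =>
    toSpecBase_D X (RingHom.id X.Γ) f
  refine ⟨fun x _ => ?_, fun f n g h => ?_, ?_, ?_⟩
  · obtain ⟨z, rfl⟩ := hb.2 x
    obtain ⟨n, g, rfl⟩ := exists_cover z
    exact ⟨n, g, hsup g⟩
  · rw [← zariskiLattice_D_le_sup_iff, ← inf_eq_left]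
    refine hb.1 ?_
    rw [map_inf, hsup, inf_eq_left, hD]
    exact h
  · rintro f x hx hxf t
    -- Since `x` is a variable, it can be replaced by the image of D(f) under η, where the sheaf
    -- part of η takes its values.
    obtain rfl := hxf.trans (hD f).symm
    obtain ⟨s, rfl⟩ := (hs _).2 t
    have := isLocalization_specPresheaf X.Γ f
    obtain ⟨⟨r, ⟨_, k, rfl⟩⟩, hr⟩ := IsLocalization.surj (Submonoid.powers f) s
    replace hr : s * ofRing _ (f ^ k) = ofRing _ r := hr
    refine ⟨k, r, ?_⟩
    have h1 := congrArg (toSpecSharp X (RingHom.id X.Γ) _) hr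
    rw [map_mul, toSpecSharp_D, toSpecSharp_D, RingHom.id_apply, RingHom.id_apply, map_pow] at h1
    rw [← h1, mul_comm]
  · rintro f x hx hxf r hr
    obtain rfl := hxf.trans (hD f).symm
    have := isLocalization_specPresheaf X.Γ f
    have h1 : ofRing (ZariskiLattice.D f) r = 0 := (hs _).1 (by
      rw [toSpecSharp_D, map_zero]
      exact hr)
    obtain ⟨⟨_, k, rfl⟩, hk⟩ := (IsLocalization.map_eq_zero_iff (Submonoid.powers f) _ r).1 h1
    exact ⟨k, hk⟩

/-- The radical condition makes η reflect the order, hence injective on lattices. On sections, basic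
elements suffice by `specHom_sharp_bijective`, and there every section of the spectrum is a fraction
with a power of `f` as denominator. -/
lemma IsAffineElement.isAffine {X : LocallyRingedLattice.{u}} (hX : X.IsAffineElement ⊤) :
    X.IsAffine := by
  have hD : ∀ f : X.Γ, toSpecBase X (RingHom.id X.Γ) (ZariskiLattice.D f) = X.D ⊤ f := fun f =>
    toSpecBase_D X (RingHom.id X.Γ) f
  have hsup : ∀ {n : ℕ} (g : Fin n → X.Γ), toSpecBase X (RingHom.id X.Γ)
      (Finset.univ.sup fun i => ZariskiLattice.D (g i)) =
        Finset.univ.sup fun i => (X.D ⊤ (g i) : X.carrier) := fun g => by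
    rw [toSpecBase_cover X _ rfl]
    simp only [toSpecBase_D, RingHom.id_apply]
  have hle : ∀ a b : ZariskiLattice X.Γ, toSpecBase X (RingHom.id X.Γ) a ≤
      toSpecBase X (RingHom.id X.Γ) b → a ≤ b := fun a b h => by
    obtain ⟨n, f, rfl⟩ := exists_cover a
    obtain ⟨m, g, rfl⟩ := exists_cover b
    rw [hsup, hsup] at h
    exact Finset.sup_le fun i _ => zariskiLattice_D_le_sup_iff.2 (hX.mem_radical _ _ _
      ((Finset.le_sup (f := fun i => (X.D ⊤ (f i) : X.carrier)) (Finset.mem_univ i)).trans h))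
  refine isIso_of_bijective (η X) ⟨fun a b h => le_antisymm (hle _ _ h.le) (hle _ _ h.ge),
    fun x => ?_⟩ (specHom_sharp_bijective fun f => ?_)
  · obtain ⟨n, g, hg⟩ := hX.exists_eq_sup x le_top
    exact ⟨_, (hsup g).trans hg.symm⟩
  · change Function.Bijective (toSpecSharp X (RingHom.id X.Γ) (ZariskiLattice.D f))
    have := isLocalization_specPresheaf X.Γ f
    have hunit : IsUnit (ofRing (ZariskiLattice.D f) f) :=
      IsLocalization.Away.algebraMap_isUnit f
    constructor
    · rw [injective_iff_map_eq_zero]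
      intro s hs
      obtain ⟨⟨r, ⟨_, k, rfl⟩⟩, hr⟩ := IsLocalization.surj (Submonoid.powers f) s
      replace hr : s * ofRing _ (f ^ k) = ofRing _ r := hr
      have h1 := congrArg (toSpecSharp X (RingHom.id X.Γ) _) hr
      rw [map_mul, hs, zero_mul, toSpecSharp_D] at h1
      -- The numerator `r` vanishes on D(f) in `X`, so a power of `f` kills it; as `f` is a unit in
      -- the localization, the fraction is zero.
      obtain ⟨n, hn⟩ := hX.exists_pow_mul_eq_zero f _ le_top (hD f) r h1.symm
      have h2 := congrArg (ofRing (ZariskiLattice.D f)) hn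
      rw [map_mul, ← hr, map_zero, map_pow, map_pow, (hunit.pow n).mul_right_eq_zero,
        (hunit.pow k).mul_left_eq_zero] at h2
      exact h2
    · intro t
      obtain ⟨n, r, hr⟩ := hX.exists_res_eq f _ le_top (hD f) t
      obtain ⟨a, ha⟩ := hunit.pow n
      refine ⟨↑a⁻¹ * ofRing (R := X.Γ) (ZariskiLattice.D f) r, ?_⟩
      have h1 : X.res le_top f ^ n = toSpecSharp X (RingHom.id X.Γ) (ZariskiLattice.D f) a := by
        rw [ha, map_pow, toSpecSharp_D]
        rfl
      rw [map_mul, toSpecSharp_D, RingHom.id_apply, hr, h1, ← mul_assoc, ← map_mul,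
        Units.inv_mul, map_one, one_mul]

/-- Sections, restrictions and supports of `X|_v` are those of `X`; only finite joins have to be
moved across the coercion. -/
lemma isAffineElement_restrict_iff {X : LocallyRingedLattice.{u}} {v : X.carrier} :
    (X.restrict v).IsAffineElement ⊤ ↔ X.IsAffineElement v := by
  have hsup : ∀ {n : ℕ} (g : Fin n → X.sec v),
      ((Finset.univ.sup fun i => ((X.restrict v).D ⊤ (g i) : (X.restrict v).carrier) :
        Set.Iic v) : X.carrier) = Finset.univ.sup fun i => (X.D v (g i) : X.carrier) := fun g =>
    Finset.apply_sup_eq_sup_comp (fun a : Set.Iic v => (a : X.carrier)) (fun _ _ => rfl) rfl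
  constructor
  · intro h
    refine ⟨fun x hx => ?_, fun f n g hf => ?_, fun f x hx hxf t => ?_, fun f x hx hxf r hr => ?_⟩
    · obtain ⟨n, g, hg⟩ := h.exists_eq_sup ⟨x, hx⟩ le_top
      exact ⟨n, g, (congrArg Subtype.val hg).trans (hsup g)⟩
    · exact h.mem_radical f n g (Subtype.coe_le_coe.1 (hf.trans (hsup g).ge))
    · exact h.exists_res_eq f ⟨x, hx⟩ le_top (Subtype.ext hxf) t
    · exact h.exists_pow_mul_eq_zero f ⟨x, hx⟩ le_top (Subtype.ext hxf) r hr
  · intro h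
    refine ⟨fun x hx => ?_, fun f n g hf => ?_, fun f x hx hxf t => ?_, fun f x hx hxf r hr => ?_⟩
    · obtain ⟨n, g, hg⟩ := h.exists_eq_sup x.1 x.2
      exact ⟨n, g, Subtype.ext (hg.trans (hsup g).symm)⟩
    · exact h.mem_radical f n g ((Subtype.coe_le_coe.2 hf).trans (hsup g).le)
    · exact h.exists_res_eq f x.1 x.2 (congrArg Subtype.val hxf) t
    · exact h.exists_pow_mul_eq_zero f x.1 x.2 (congrArg Subtype.val hxf) r hr

lemma isAffine_restrict_iff {X : LocallyRingedLattice.{u}} {v : X.carrier} :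
    (X.restrict v).IsAffine ↔ X.IsAffineElement v :=
  ⟨fun h => isAffineElement_restrict_iff.1 h.isAffineElement_top,
    fun h => (isAffineElement_restrict_iff.2 h).isAffine⟩

/-! ### Naturality of η. -/

lemma toSpecSharp_ofRing {R : Type u} [CommRing R] (X : LocallyRingedLattice.{u}) (φ : R →+* X.Γ)
    (v : ZariskiLattice R) (r : R) :
    toSpecSharp X φ v (ofRing _ r) = X.res le_top (φ r) := by
  have h := toSpecSharp_naturality X φ (le_top : v ≤ ⊤) (ofRing ⊤ r)
  rw [res_ofRing, toSpecSharp_top, restr_restr] at h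
  exact h

/-- The support on the spectrum is obtained by choice and does not unfold to a basic element, so its
image is computed from the fact that η preserves supports. -/
lemma η_base_D_ofRing (X : LocallyRingedLattice.{u}) (a : X.Γ) :
    (η X).toHom.base (specD X.Γ ⊤ (ofRing ⊤ a) : ZariskiLattice X.Γ) = X.D ⊤ a := by
  refine ((η X).preserves ⊤ (ofRing ⊤ a)).trans ?_
  have h : (η X).toHom.sharp ⊤ (ofRing ⊤ a) = X.res le_top a :=
    toSpecSharp_ofRing X (RingHom.id X.Γ) ⊤ a
  rw [h, D_res, map_top, inf_top_eq]

/-- Naturality of `η` for morphisms of ringed lattices preserving the invertibility supports. -/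
lemma η_naturality {X Y : LocallyRingedLattice.{u}} (F : Y.toRingedLattice ⟶ X.toRingedLattice)
    (hF : PreservesInvertibilitySupport F) :
    (η Y).toHom ≫ F = (Spec.map F.globalSections).toHom ≫ (η X).toHom := by
  refine specHom_ext (fun f => ?_) fun r => ?_
  · change F.base (toSpecBase Y (RingHom.id Y.Γ) (ZariskiLattice.D f)) =
      (η X).toHom.base (toSpecBase (Spec X.Γ) ((ofRing ⊤).comp F.globalSections)
        (ZariskiLattice.D f))
    -- Preservation of supports enters only here, on lattices; the comparison of sections needs only
    -- naturality.
    rw [toSpecBase_D, toSpecBase_D, hF]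
    refine Eq.trans ?_ (η_base_D_ofRing X (F.globalSections f)).symm
    change _ = (X.D ⊤ (X.res (map_top F.base).ge (F.sharp ⊤ f)) : X.carrier)
    rw [D_res, inf_top_eq]
    rfl
  · change F.sharp _ (toSpecSharp Y (RingHom.id Y.Γ) ⊤ (ofRing ⊤ r)) =
      X.res _ (toSpecSharp X (RingHom.id X.Γ) _
        (toSpecSharp (Spec X.Γ) ((ofRing ⊤).comp F.globalSections) ⊤ (ofRing ⊤ r)))
    have h1 : toSpecSharp (Spec X.Γ) ((ofRing ⊤).comp F.globalSections) ⊤ (ofRing ⊤ r) =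
        ofRing _ (F.globalSections r) :=
      toSpecSharp_ofRing (Spec X.Γ) ((ofRing ⊤).comp F.globalSections) ⊤ r
    rw [h1, toSpecSharp_ofRing, toSpecSharp_ofRing, F.naturality]
    refine (Eq.trans (restr_restr X.presheaf _ le_top _) ?_).symm
    exact restr_restr X.presheaf _ (map_top F.base).ge (F.sharp ⊤ r)

/-! ### Locality of preservation and affine refinements. -/

variable {X Y : LocallyRingedLattice.{u}}

lemma preserves_restrict {π : Y.toRingedLattice ⟶ X.toRingedLattice}
    (hπ : PreservesInvertibilitySupport π) {w : Y.carrier} {v : X.carrier} (h : v ≤ π.base w) :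
    PreservesInvertibilitySupport (X := Y.restrict w) (Y := X.restrict v)
      (RingedLattice.Hom.restrict π w v h) := fun x s => Subtype.ext (by
  change π.base (Y.D x.1 s : Y.carrier) ⊓ v =
    X.D (π.base x.1 ⊓ v) (X.res inf_le_left (π.sharp x.1 s))
  refine (congrArg (· ⊓ v) (hπ x.1 s)).trans ?_
  rw [D_res, ← inf_assoc, inf_eq_left.2 (D_le X _)])

/-- Cancelling the isomorphism η exhibits `F` as a composite of morphisms of locally ringed
lattices. -/
lemma preserves_of_η_comp_eq (hY : Y.IsAffine) {F : Y.toRingedLattice ⟶ X.toRingedLattice}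
    (G : Spec Y.Γ ⟶ X) (hF : (η Y).toHom ≫ F = G.toHom) : PreservesInvertibilitySupport F := by
  have hY : IsIso (η Y) := hY
  have h1 : (inv (η Y)).toHom ≫ (η Y).toHom = 𝟙 _ :=
    congrArg Hom.toHom (IsIso.inv_hom_id (η Y))
  have h2 : F = (inv (η Y) ≫ G).toHom := by
    change F = (inv (η Y)).toHom ≫ G.toHom
    rw [← hF, ← Category.assoc, h1, Category.id_comp]
  rw [h2]
  exact (inv (η Y) ≫ G).preserves

/-- Preservation of the invertibility supports may be checked locally. -/
lemma preserves_of_restrict {π : Y.toRingedLattice ⟶ X.toRingedLattice} {n : ℕ}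
    {v : Fin n → X.carrier} (hv : ⊤ = Finset.univ.sup v)
    (h : ∀ i, ∃ (w : Y.carrier) (h : v i ≤ π.base w), PreservesInvertibilitySupport
      (X := Y.restrict w) (Y := X.restrict (v i)) (RingedLattice.Hom.restrict π w (v i) h)) :
    PreservesInvertibilitySupport π := by
  intro y s
  apply le_antisymm
  · have hle : π.base (Y.D y s : Y.carrier) ≤ π.base y := OrderHomClass.mono π.base (D_le Y s)
    refine (le_D_iff X _ hle).2 ?_
    rw [← π.naturality (D_le Y s)]
    exact (isUnit_res_D Y s).map _
  · rw [inf_cover X hv (le_top : (X.D (π.base y) (π.sharp y s) : X.carrier) ≤ ⊤)]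
    refine Finset.sup_le fun i _ => ?_
    obtain ⟨w, hw, hp⟩ := h i
    -- As `y` need not lie below `w`, the section is first restricted to `y ⊓ w`; nothing is lost,
    -- since `v i` lies below the pullback of `w`.
    have h1 := congrArg Subtype.val (hp ⟨y ⊓ w, inf_le_right⟩ (Y.res inf_le_left s))
    change π.base (Y.D (y ⊓ w) (Y.res inf_le_left s) : Y.carrier) ⊓ v i =
      X.D (π.base (y ⊓ w) ⊓ v i)
        (X.res inf_le_left (π.sharp (y ⊓ w) (Y.res inf_le_left s))) at h1
    rw [π.naturality, D_res, D_res, D_res, map_inf, map_inf] at h1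
    refine le_trans (le_trans ?_ h1.ge) (inf_le_left.trans inf_le_left)
    exact le_inf (le_inf inf_le_left (le_inf (inf_le_left.trans (D_le X _))
      (inf_le_right.trans hw))) (le_inf (le_inf (inf_le_left.trans (D_le X _))
      (inf_le_right.trans hw)) inf_le_right)

/-- Each meet of an affine `v a` with some `u j` lies below `v a`, hence is a finite join of basic
elements of `v a`; these are affine and together they cover. -/
lemma exists_affine_refinement (hX : X.IsQcqsScheme) {m : ℕ} {u : Fin m → X.carrier}
    (hu : ⊤ = Finset.univ.sup u) :
    ∃ (n : ℕ) (v : Fin n → X.carrier), X.IsAffineCover v ∧ ∀ i, ∃ j, v i ≤ u j := by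
  obtain ⟨n, v, hv⟩ := hX
  choose k g hg using fun p : Fin n × Fin m =>
    (isAffine_restrict_iff.1 (hv.affine p.1)).exists_eq_sup (v p.1 ⊓ u p.2) inf_le_left
  -- Flattens the pairs together with their basic elements into a single finite index.
  let e := Fintype.equivFin (Σ p, Fin (k p))
  have hle : ∀ p (i : Fin (k p)), (X.D (v p.1) (g p i) : X.carrier) ≤ v p.1 ⊓ u p.2 :=
    fun p i => by
      rw [hg p]
      exact Finset.le_sup (f := fun i => (X.D (v p.1) (g p i) : X.carrier)) (Finset.mem_univ i)
  refine ⟨_, fun i => X.D (v (e.symm i).1.1) (g (e.symm i).1 (e.symm i).2), ⟨?_, fun i => ?_⟩,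
    fun i => ⟨(e.symm i).1.2, (hle _ _).trans inf_le_right⟩⟩
  · refine (top_le_iff.1 ?_).symm
    rw [hv.cover]
    refine Finset.sup_le fun a _ => ?_
    rw [inf_cover X hu (le_top : v a ≤ ⊤)]
    refine Finset.sup_le fun j _ => ?_
    rw [hg (a, j)]
    refine Finset.sup_le fun i _ => ?_
    have h := Finset.le_sup (f := fun i =>
      (X.D (v (e.symm i).1.1) (g (e.symm i).1 (e.symm i).2) : X.carrier))
      (Finset.mem_univ (e ⟨(a, j), i⟩))
    rwa [e.symm_apply_apply] at h
  · exact isAffine_restrict_iff.2 ((isAffine_restrict_iff.1 (hv.affine _)).of_D _)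

end LocallyRingedLattice

/-- For qcqs-schemes `X` and `Y`, a morphism of ringed lattices `π : X → Y` in the opposite
category, i.e. `π^* : L_Y → L_X` with `π^♯ : 𝒪_Y → π_*𝒪_X`, is locally affine if and only if it is
a morphism of locally ringed lattices. -/
theorem mainTheorem7 (X Y : LocallyRingedLattice.{u}) (hX : X.IsQcqsScheme) (hY : Y.IsQcqsScheme)
    (π : Y.toRingedLattice ⟶ X.toRingedLattice) :
    LocallyRingedLattice.IsLocallyAffine π ↔ PreservesInvertibilitySupport π := by
  constructor
  · rintro ⟨n, v, m, w, hv, hw, h⟩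
    refine LocallyRingedLattice.preserves_of_restrict hv.cover fun i => ?_
    obtain ⟨j, hij, hη⟩ := h i
    exact ⟨w j, hij, LocallyRingedLattice.preserves_of_η_comp_eq (hw.affine j)
      (LocallyRingedLattice.Spec.map (RingedLattice.Hom.restrict π (w j) (v i) hij).globalSections ≫
        LocallyRingedLattice.η (X.restrict (v i))) hη⟩
  · intro hπ
    obtain ⟨m, w, hw⟩ := hY
    -- Pulling back the cover of `Y` and refining it makes every piece of `X` lie over a single
    -- affine piece of `Y`.
    have hcov : ⊤ = Finset.univ.sup fun j => π.base (w j) := by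
      rw [← map_top π.base, hw.cover]
      exact map_finset_sup _ _ _
    obtain ⟨n, v, hv, hvw⟩ := LocallyRingedLattice.exists_affine_refinement hX hcov
    exact ⟨n, v, m, w, hv, hw, fun i => ⟨(hvw i).choose, (hvw i).choose_spec,
      LocallyRingedLattice.η_naturality _ (LocallyRingedLattice.preserves_restrict hπ _)⟩⟩
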